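/- **Theorem (Sufficient conditions for full capacity).** For a finite compactly supported Borel measure $\mu$ on $\mathbb{C}$ let $I(\mu)=\iint(-\log|z-w|)\,d\mu(z)\,d\mu(w)\in(-\infty,+\infty]$, and for $E\subset\mathbb{C}$ let $\mathrm{Cap}(E)=\exp(-\inf I(\mu))$, where the infimum is taken over all Borel probability measures $\mu$ whose support is a compact subset of $E$ (with $e^{-\infty}=0$). Fix $\lambda>0$ and, for $k\in\mathbb{N}$, let $I_k$ be the open interval with center $c_k\in(0,1)$ and length $l_k=e^{-\lambda k}$. Put $\mathcal{A}_n=\{n,\dots,2n-1\}$ and $\mathcal{A}_{n,q}=\mathcal{A}_n\cup\mathcal{A}_{2n}\cup\dots\cup\mathcal{A}_{2^qn}$. Assume: - **A.1 (distribution)** there is $\phi\in L^1([0,1],dx)$ with $\phi>0$ a.e. such that for every $f\in C([0,1])$ $$\frac{1}{\#\mathcal{A}_n}\sum_{k\in\mathcal{A}_n}f(c_k)\to\int_0^1 f(x)\phi(x)\,dx\qquad(n\to\infty);$$ and there is a sequence $q(n)$ of non-negative integers with $q(n)\to\infty$ such that - **A.2 (log-average spacing)** for every $\varepsilon>0$ there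 is $\delta>0$ such that for all large enough $n$ and all $n',n''\in\{n,2n,\dots,2^{q(n)}n\}$ $$\frac{1}{\#(\mathcal{A}_{n'}\times\mathcal{A}_{n''})}\sum(-\log|c_i-c_j|)<\varepsilon,$$ where the sum is over $i\in\mathcal{A}_{n'}$, $j\in\mathcal{A}_{n''}$ with $i\ne j$ and $|c_i-c_j|<\delta$ (with $-\log 0=+\infty$); - **A.3 (gap control)** for every $\varepsilon>0$, for all large enough $n$, every $i\neq j$ in $\mathcal{A}_{n,q(n)}$ satisfy $c_i\ne c_j$ and $$\frac{l_i+l_j}{2|c_i-c_j|}<\varepsilon.$$ Then the set $S=\bigcap_m\bigcup_{k\ge m}I_k$ is a subset of $[0,1]$ and has full capacity on it: $\mathrm{Cap}(S)=\mathrm{Cap}([0,1])>0$. -/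

import Mathlib

open Set Filter Topology MeasureTheory

noncomputable section

namespace LogCap

/-- The logarithmic kernel `-log |z - w|`, with value `+∞` on the diagonal. -/
def logKernel (z w : ℂ) : EReal := -ENNReal.log (edist z w)

/-- The interaction `∬ -log |z - w| dν(z) dμ(w)`, as the difference of the integrals of the
positive and the negative part of the kernel. For finite measures with compact support the
second integral is finite, so the difference is meaningful and takes values in `(-∞, +∞]`. -/
def interaction (ν μ : Measure ℂ) : EReal :=
  ((∫⁻ w, ∫⁻ z, (logKernel z w).toENNReal ∂ν ∂μ : ENNReal) : EReal) -
    ((∫⁻ w, ∫⁻ z, (-logKernel z w).toENNReal ∂ν ∂μ : ENNReal) : EReal)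

/-- The energy of a measure. -/
def energy (μ : Measure ℂ) : EReal := interaction μ μ

/-- Logarithmic capacity: `exp (-inf I(μ))`, the infimum over the Borel probability measures
whose support is a compact subset of `E` (here `exp (-∞) = 0` and `inf ∅ = +∞`). -/
def capacity (E : Set ℂ) : ENNReal :=
  EReal.exp (-(⨅ (μ : Measure ℂ) (_ : IsProbabilityMeasure μ) (_ : IsCompact μ.support)
    (_ : μ.support ⊆ E), energy μ))

/-- `E` is a subset of `J` of full capacity on `J`. -/
def HasFullCapacityOn (E J : Set ℂ) : Prop := E ⊆ J ∧ capacity E = capacity J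

/-- The unit interval as a subset of `ℂ`. -/
def unitInterval : Set ℂ := (fun x : ℝ => (x : ℂ)) '' Icc 0 1

/-- The open interval with center `c k` and length `l k`. -/
def interval (c l : ℕ → ℝ) (k : ℕ) : Set ℝ := Ioo (c k - l k / 2) (c k + l k / 2)

/-- The set `⋂ₘ ⋃_{k ≥ m} I_k`, as a subset of `ℂ`. -/
def limsupSet (c l : ℕ → ℝ) : Set ℂ :=
  (fun x : ℝ => (x : ℂ)) '' (⋂ m : ℕ, ⋃ k : ℕ, ⋃ _ : m ≤ k, interval c l k)

/-- The index block `{n, …, 2n - 1}`. -/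
def block (n : ℕ) : Finset ℕ := Finset.Ico n (2 * n)

/-- The union of the blocks of `n, 2n, …, 2^q n`. -/
def multiBlock (n q : ℕ) : Finset ℕ :=
  (Finset.range (q + 1)).biUnion fun s => block (2 ^ s * n)

/-- The centers are distributed with respect to the density `φ ∈ L¹([0,1])`, `φ > 0` a.e. -/
def Distributed (c : ℕ → ℝ) (φ : ℝ → ℝ) : Prop :=
  IntegrableOn φ (Icc 0 1) ∧ (∀ᵐ x ∂(volume.restrict (Icc (0 : ℝ) 1)), 0 < φ x) ∧
  ∀ f : ℝ → ℝ, ContinuousOn f (Icc 0 1) →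
    Tendsto (fun n : ℕ => (∑ k ∈ block n, f (c k)) / ((block n).card : ℝ)) atTop
      (𝓝 (∫ x in Icc (0 : ℝ) 1, f x * φ x))

/-- Log-average spacing. The clause `c i ≠ c j` says that no term of the sum is `-log 0 = +∞`. -/
def LogAverageSpacing (c : ℕ → ℝ) (q : ℕ → ℕ) : Prop :=
  ∀ ε : ℝ, 0 < ε → ∃ δ : ℝ, 0 < δ ∧ ∀ᶠ n : ℕ in atTop, ∀ s ≤ q n, ∀ t ≤ q n,
    (∀ i ∈ block (2 ^ s * n), ∀ j ∈ block (2 ^ t * n), i ≠ j → c i ≠ c j) ∧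
    (∑ p ∈ (block (2 ^ s * n) ×ˢ block (2 ^ t * n)).filter
        (fun p => p.1 ≠ p.2 ∧ |c p.1 - c p.2| < δ), -Real.log |c p.1 - c p.2|) /
      ((block (2 ^ s * n) ×ˢ block (2 ^ t * n)).card : ℝ) < ε

/-- Gap control. The clause `c i ≠ c j` says that the quotient is finite. -/
def GapControl (c l : ℕ → ℝ) (q : ℕ → ℕ) : Prop :=
  ∀ ε : ℝ, 0 < ε → ∀ᶠ n : ℕ in atTop,
    ∀ i ∈ multiBlock n (q n), ∀ j ∈ multiBlock n (q n), i ≠ j →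
      c i ≠ c j ∧ (l i + l j) / (2 * |c i - c j|) < ε

end LogCap

end

open scoped ENNReal NNReal BoundedContinuousFunction

noncomputable section

namespace LogCap

/-! ### The positive part of the logarithmic kernel on the line -/

/-! On `[0, 1]` the kernel `-log |x - y|` is nonnegative, so the energy of a measure carried there
is the integral of the positive part `logPos`, and one can compute in `ℝ≥0∞`. Since capacity is
monotone, it suffices to move any probability measure of finite energy on `[0, 1]` onto a compact
subset of `S` at an arbitrarily small cost in energy (`exists_measure_on_limsup`).

The heart is one step of this kind (`exists_measure_on_intervals`): an absolutely continuous `ν`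
carried by an open `U` is replaced by one carried by a compact part of `U ∩ ⋃_{k ≥ m} I_k`. As `φ >
0` a.e., `ν` has a density with respect to `φ dx`; as `φ dx` has finite energy by A.1 and A.2, this
density may be replaced by a continuous `g` with compact support in `U`. Then `g φ dx` is
discretized: the middle half of `I_k` receives mass about `g(c_k) / ((q+1) N)` for `k` in the block
of `N = 2^s n`, `s ≤ q`.

In the energy of the discretization (`eventually_mutualEnergy_discretization_le`), A.3 replaces the
interaction of two distinct cells by `-log |c_i - c_j|` up to a small error. The truncated kernel
converges by A.1, and what truncation removes is small by A.2. The self-energy of a cell is `λk +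
O(1)`; one block has `N` cells with `k < 2N`, so its diagonal is of order `N²`, just what the
weights compensate: a single block would leave an error of order one. Spreading the mass over `q +
1` blocks reduces the diagonal to `O(1/(q+1))`, and `q → ∞` removes it.

After a preliminary smoothing that makes the initial measure absolutely continuous, the step is
iterated inside nested relatively compact open sets with summable errors. A weak limit is carried by
the intersection of their closures, which lies in `S`, and energy is lower semicontinuous. -/

/-- The positive part of `-log |x - y|`, with value `∞` on the diagonal. -/
def logPos (x y : ℝ) : ℝ≥0∞ := (-ENNReal.log (edist x y)).toENNReal

theorem continuous_logPos : Continuous fun p : ℝ × ℝ => logPos p.1 p.2 := by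
  have h : Continuous fun p : ℝ × ℝ => -ENNReal.log (edist p.1 p.2) :=
    continuous_neg.comp (ENNReal.continuous_log.comp (continuous_fst.edist continuous_snd))
  exact h.ereal_toENNReal

theorem measurable_logPos : Measurable fun p : ℝ × ℝ => logPos p.1 p.2 :=
  continuous_logPos.measurable

theorem measurable_logPos_left (y : ℝ) : Measurable fun x => logPos x y :=
  measurable_logPos.comp (measurable_id.prodMk measurable_const)

theorem logPos_comm (x y : ℝ) : logPos x y = logPos y x := by
  simp [logPos, edist_comm]

theorem logPos_self (x : ℝ) : logPos x x = ∞ := by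
  simp [logPos]

theorem logPos_of_ne {x y : ℝ} (h : x ≠ y) :
    logPos x y = ENNReal.ofReal (-Real.log |x - y|) := by
  have hp : 0 < |x - y| := abs_pos.2 (sub_ne_zero.2 h)
  rw [logPos, edist_dist, Real.dist_eq, ENNReal.log_ofReal_of_pos hp, ← EReal.coe_neg,
    EReal.toENNReal_of_ne_top (EReal.coe_ne_top _), EReal.toReal_coe]

theorem logPos_le_of_le {x y r : ℝ} (hr : 0 < r) (h : r ≤ |x - y|) :
    logPos x y ≤ ENNReal.ofReal (-Real.log r) := by
  have hne : x ≠ y := by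
    rintro rfl
    simp at h
    linarith
  rw [logPos_of_ne hne]
  exact ENNReal.ofReal_le_ofReal (neg_le_neg (Real.log_le_log hr h))

/-- The logarithm turns a dilation into an additive constant, and `ENNReal.ofReal` is subadditive.
This reduces estimates at scale `t` to unit scale. -/
theorem logPos_le_scale {t : ℝ} (ht : 0 < t) (x y : ℝ) :
    logPos x y ≤ ENNReal.ofReal (-Real.log t) + logPos (x / t) (y / t) := by
  by_cases h : x = y
  · subst h
    simp [logPos_self]
  have h' : x / t ≠ y / t := fun e => h ((div_left_inj' ht.ne').1 e)
  have hp : 0 < |x - y| := abs_pos.2 (sub_ne_zero.2 h)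
  rw [logPos_of_ne h, logPos_of_ne h', ← sub_div, abs_div, abs_of_pos ht,
    Real.log_div hp.ne' ht.ne']
  refine le_trans (le_of_eq ?_) ENNReal.ofReal_add_le
  congr 1
  ring

/-- By translation `y = 0`; the bound is the value of the integral of `-log |u|` over `[-1, 1]`. -/
theorem lintegral_logPos_le (y : ℝ) : ∫⁻ x, logPos x y ≤ 2 := by
  have h1 : ∀ x, logPos x y = logPos (x - y) 0 := fun x => by
    simp [logPos, edist_dist, Real.dist_eq]
  simp_rw [h1]
  rw [lintegral_sub_right_eq_self (fun u => logPos u 0) y]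
  have h2 : ∀ᵐ u : ℝ, logPos u 0 ≤
      (Ioc (-1 : ℝ) 1).indicator (fun u => ENNReal.ofReal (-Real.log u)) u := by
    filter_upwards [compl_mem_ae_iff.2 (measure_singleton (0 : ℝ))] with u hu
    have hu0 : u ≠ 0 := hu
    rw [logPos_of_ne hu0, sub_zero, Real.log_abs]
    by_cases hm : u ∈ Ioc (-1 : ℝ) 1
    · rw [indicator_of_mem hm]
    · rw [indicator_of_notMem hm]
      have : 1 ≤ |u| := by
        by_contra hlt
        push Not at hlt
        exact hm ⟨(abs_lt.1 hlt).1, (abs_lt.1 hlt).2.le⟩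
      rw [ENNReal.ofReal_of_nonpos]
      rw [← Real.log_abs]
      linarith [Real.log_nonneg this]
  refine (lintegral_mono_ae h2).trans ?_
  rw [lintegral_indicator measurableSet_Ioc, ← ofReal_integral_eq_lintegral_ofReal]
  · rw [← intervalIntegral.integral_of_le (by norm_num), intervalIntegral.integral_neg,
      integral_log]
    norm_num
  · have := (intervalIntegral.intervalIntegrable_log' (a := -1) (b := 1)).neg
    rwa [intervalIntegrable_iff_integrableOn_Ioc_of_le (by norm_num)] at this
  · refine (ae_restrict_iff' measurableSet_Ioc).2 (Eventually.of_forall fun u hu => ?_)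
    have : |u| ≤ 1 := abs_le.2 ⟨hu.1.le, hu.2⟩
    have := Real.log_nonpos (abs_nonneg u) this
    rw [Real.log_abs] at this
    simpa using this

/-! ### Uniform measures on intervals -/

/-- The uniform probability measure on `[a, a + t]`. -/
def unif (a t : ℝ) : Measure ℝ := (ENNReal.ofReal t)⁻¹ • volume.restrict (Icc a (a + t))

theorem isProbabilityMeasure_unif (a : ℝ) {t : ℝ} (ht : 0 < t) :
    IsProbabilityMeasure (unif a t) := by
  constructor
  simp [unif, ENNReal.inv_mul_cancel, ht]

theorem unif_absolutelyContinuous (a t : ℝ) : unif a t ≪ volume :=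
  (Measure.smul_absolutelyContinuous).trans Measure.absolutelyContinuous_restrict

theorem unif_compl (a t : ℝ) : unif a t (Icc a (a + t))ᶜ = 0 := by
  simp [unif]

theorem lintegral_logPos_unif_le (a y : ℝ) {t : ℝ} (ht : 0 < t) :
    ∫⁻ x, logPos x y ∂(unif a t) ≤ ENNReal.ofReal (-Real.log t) + 2 := by
  have := isProbabilityMeasure_unif a ht
  calc ∫⁻ x, logPos x y ∂(unif a t)
      ≤ ∫⁻ x, (ENNReal.ofReal (-Real.log t) + logPos (x / t) (y / t)) ∂(unif a t) :=
        lintegral_mono fun x => logPos_le_scale ht x y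
    _ = ENNReal.ofReal (-Real.log t) + ∫⁻ x, logPos (x / t) (y / t) ∂(unif a t) := by
        rw [lintegral_add_left measurable_const]
        simp
    _ ≤ _ := by
        gcongr
        rw [unif, lintegral_smul_measure, smul_eq_mul]
        have h0 : ENNReal.ofReal t ≠ 0 := by simpa using ht
        have h1 : ∫⁻ x, logPos (x / t) (y / t) = ENNReal.ofReal t * ∫⁻ x, logPos x (y / t) := by
          have hm := Real.map_volume_mul_right (inv_ne_zero ht.ne')
          have h2 := lintegral_map (μ := volume) (measurable_logPos_left (y / t))
            (measurable_mul_const t⁻¹)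
          rw [hm, lintegral_smul_measure, inv_inv, abs_of_pos ht] at h2
          simpa [div_eq_mul_inv] using h2.symm
        calc (ENNReal.ofReal t)⁻¹ * ∫⁻ x in Icc a (a + t), logPos (x / t) (y / t)
            ≤ (ENNReal.ofReal t)⁻¹ * ∫⁻ x, logPos (x / t) (y / t) := by
              gcongr
              exact Measure.restrict_le_self
          _ = ∫⁻ x, logPos x (y / t) := by
              rw [h1, ← mul_assoc, ENNReal.inv_mul_cancel h0 ENNReal.ofReal_ne_top, one_mul]
          _ ≤ 2 := lintegral_logPos_le _

/-! ### Mutual energy -/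

/-- The mutual energy `∬ log⁺ (1 / |x - y|) dν(x) dμ(y)`. -/
def mutualEnergy (ν μ : Measure ℝ) : ℝ≥0∞ := ∫⁻ y, ∫⁻ x, logPos x y ∂ν ∂μ

theorem mutualEnergy_eq_prod (ν μ : Measure ℝ) [SFinite ν] [SFinite μ] :
    mutualEnergy ν μ = ∫⁻ p, logPos p.1 p.2 ∂(ν.prod μ) :=
  (lintegral_prod_symm' _ measurable_logPos).symm

theorem measurable_lintegral_logPos (ν : Measure ℝ) [SFinite ν] :
    Measurable fun y => ∫⁻ x, logPos x y ∂ν :=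
  measurable_logPos.lintegral_prod_left'

theorem mutualEnergy_mono {ν ν' μ μ' : Measure ℝ} (h : ν ≤ ν') (h' : μ ≤ μ') :
    mutualEnergy ν μ ≤ mutualEnergy ν' μ' :=
  lintegral_mono' h' fun _ => lintegral_mono' h le_rfl

theorem mutualEnergy_smul (a : ℝ≥0∞) (ν : Measure ℝ) [SFinite ν] :
    mutualEnergy (a • ν) (a • ν) = a * a * mutualEnergy ν ν := by
  simp only [mutualEnergy, lintegral_smul_measure, smul_eq_mul]
  rw [lintegral_const_mul _ (measurable_lintegral_logPos ν), mul_assoc]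

/-! ### Smoothing a measure of finite energy -/

/-- The law of `(1 - t) X + t U`, where `X` has law `ν` and `U` is uniform on `[0, 1]`. -/
def smoothing (ν : Measure ℝ) (t : ℝ) : Measure ℝ :=
  (ν.prod (unif 0 1)).map fun p => (1 - t) * p.1 + t * p.2

instance instIsProbabilityMeasureUnif : IsProbabilityMeasure (unif 0 1) :=
  isProbabilityMeasure_unif 0 one_pos

theorem measurable_convexComb (t : ℝ) : Measurable fun p : ℝ × ℝ => (1 - t) * p.1 + t * p.2 := by
  fun_prop

instance instIsProbabilityMeasureSmoothing (ν : Measure ℝ) [IsProbabilityMeasure ν] (t : ℝ) :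
    IsProbabilityMeasure (smoothing ν t) :=
  Measure.isProbabilityMeasure_map (measurable_convexComb t).aemeasurable

theorem unif_mem_Icc : ∀ᵐ u ∂(unif 0 1), u ∈ Icc (0 : ℝ) 1 := by
  have := unif_compl 0 1
  rwa [zero_add] at this

/-- For each fixed `x` the law of `(1 - t) x + t U` is already absolutely continuous; integrate over
`x`. -/
theorem smoothing_absolutelyContinuous (ν : Measure ℝ) {t : ℝ} (ht : t ≠ 0) :
    smoothing ν t ≪ volume := by
  refine Measure.AbsolutelyContinuous.mk fun A hA h0 => ?_
  rw [smoothing, Measure.map_apply (measurable_convexComb t) hA,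
    Measure.measure_prod_null (measurable_convexComb t hA)]
  refine Eventually.of_forall fun x => ?_
  apply unif_absolutelyContinuous
  have h1 : (Prod.mk x ⁻¹' ((fun p : ℝ × ℝ => (1 - t) * p.1 + t * p.2) ⁻¹' A)) =
      (fun u => t * u) ⁻¹' ((fun u => (1 - t) * x + u) ⁻¹' A) := rfl
  rw [h1, Real.volume_preimage_mul_left ht, measure_preimage_add, h0, mul_zero]

theorem smoothing_compl_Ioo (ν : Measure ℝ) [IsProbabilityMeasure ν]
    (hν : ν (Icc 0 1)ᶜ = 0) {t : ℝ} (ht : 0 < t) (ht1 : t ≤ 1) :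
    smoothing ν t (Ioo 0 1)ᶜ = 0 := by
  have hIcc : smoothing ν t (Icc 0 1)ᶜ = 0 := by
    rw [smoothing, Measure.map_apply (measurable_convexComb t) measurableSet_Icc.compl]
    have h1 : ∀ᵐ p ∂(ν.prod (unif 0 1)), p.1 ∈ Icc (0 : ℝ) 1 :=
      Measure.quasiMeasurePreserving_fst.ae (p := fun x => x ∈ Icc (0 : ℝ) 1) hν
    have h2 : ∀ᵐ p ∂(ν.prod (unif 0 1)), p.2 ∈ Icc (0 : ℝ) 1 :=
      Measure.quasiMeasurePreserving_snd.ae unif_mem_Icc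
    change ∀ᵐ p ∂(ν.prod (unif 0 1)), (1 - t) * p.1 + t * p.2 ∈ Icc (0 : ℝ) 1
    filter_upwards [h1, h2] with p hp hq
    constructor <;> nlinarith [hp.1, hp.2, hq.1, hq.2]
  have hsub : (Ioo (0 : ℝ) 1)ᶜ ⊆ (Icc 0 1)ᶜ ∪ {0, 1} := by
    intro x hx
    by_cases h : x ∈ Icc (0 : ℝ) 1
    · right
      by_contra hne
      simp only [mem_insert_iff, mem_singleton_iff, not_or] at hne
      exact hx ⟨lt_of_le_of_ne h.1 (Ne.symm hne.1), lt_of_le_of_ne h.2 hne.2⟩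
    · exact Or.inl h
  refine measure_mono_null hsub (measure_union_null hIcc ?_)
  exact smoothing_absolutelyContinuous ν ht.ne' ((Set.toFinite _).measure_zero _)

/-- The kernel averaged over the uniform variable in its first argument. -/
def smoothKernel (t : ℝ) (z : ℝ × (ℝ × ℝ)) : ℝ≥0∞ :=
  ∫⁻ u, logPos ((1 - t) * z.1 + t * u) ((1 - t) * z.2.1 + t * z.2.2) ∂(unif 0 1)

theorem measurable_smoothKernel (t : ℝ) : Measurable (smoothKernel t) := by
  have h : Measurable fun w : (ℝ × (ℝ × ℝ)) × ℝ =>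
      ((1 - t) * w.1.1 + t * w.2, (1 - t) * w.1.2.1 + t * w.1.2.2) := by fun_prop
  exact (measurable_logPos.comp h).lintegral_prod_right'

/-- Only the first uniform variable is averaged inside the kernel; the second stays as a coordinate
of `z`, since one average already removes the singularity. -/
theorem mutualEnergy_smoothing (ν : Measure ℝ) [IsProbabilityMeasure ν] (t : ℝ) :
    mutualEnergy (smoothing ν t) (smoothing ν t) =
      ∫⁻ z, smoothKernel t z ∂(ν.prod (ν.prod (unif 0 1))) := by
  rw [mutualEnergy, lintegral_prod_symm' _ (measurable_smoothKernel t)]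
  conv_lhs => rw [smoothing]
  rw [lintegral_map (measurable_lintegral_logPos _) (measurable_convexComb t)]
  refine lintegral_congr fun q => ?_
  rw [lintegral_map (measurable_logPos_left _) (measurable_convexComb t), lintegral_prod]
  · rfl
  · refine (measurable_logPos.comp (Measurable.prodMk ?_ ?_)).aemeasurable <;> fun_prop

theorem smoothKernel_le_log {t : ℝ} (ht : 0 < t) (z : ℝ × (ℝ × ℝ)) :
    smoothKernel t z ≤ ENNReal.ofReal (-Real.log t) + 2 := by
  unfold smoothKernel
  set w := (1 - t) * z.2.1 + t * z.2.2
  set b := (1 - t) * z.1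
  calc ∫⁻ u, logPos (b + t * u) w ∂(unif 0 1)
      ≤ ∫⁻ u, (ENNReal.ofReal (-Real.log t) + logPos ((b + t * u) / t) (w / t)) ∂(unif 0 1) :=
        lintegral_mono fun u => logPos_le_scale ht _ _
    _ = ENNReal.ofReal (-Real.log t) + ∫⁻ u, logPos (b / t + u) (w / t) ∂(unif 0 1) := by
        rw [lintegral_add_left measurable_const]
        simp only [lintegral_const, measure_univ, mul_one]
        congr 2
        ext u
        congr 1
        field_simp
    _ ≤ ENNReal.ofReal (-Real.log t) + ∫⁻ u, logPos (b / t + u) (w / t) := by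
        gcongr
        simpa [unif] using Measure.restrict_le_self
    _ ≤ _ := by
        gcongr
        rw [lintegral_add_left_eq_self (fun u => logPos u (w / t)) (b / t)]
        exact lintegral_logPos_le _

/-- The uniform variables change the difference of the contracted points by at most `t`. -/
theorem smoothKernel_le_of_lt {t : ℝ} (ht : 0 < t) (ht1 : t ≤ 1) {z : ℝ × (ℝ × ℝ)}
    (hv : z.2.2 ∈ Icc (0 : ℝ) 1) (h : t < (1 - t) * |z.1 - z.2.1|) :
    smoothKernel t z ≤ ENNReal.ofReal (-Real.log ((1 - t) * |z.1 - z.2.1| - t)) := by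
  unfold smoothKernel
  calc _ ≤ ∫⁻ _, ENNReal.ofReal (-Real.log ((1 - t) * |z.1 - z.2.1| - t)) ∂(unif 0 1) := by
        refine lintegral_mono_ae ?_
        filter_upwards [unif_mem_Icc] with u hu
        refine logPos_le_of_le (by linarith) ?_
        have e : (1 - t) * z.1 + t * u - ((1 - t) * z.2.1 + t * z.2.2) =
            (1 - t) * (z.1 - z.2.1) - t * (z.2.2 - u) := by ring
        rw [e]
        have h1 : |t * (z.2.2 - u)| ≤ t := by
          rw [abs_mul, abs_of_pos ht]
          have : |z.2.2 - u| ≤ 1 := abs_le.2 ⟨by linarith [hv.1, hu.2], by linarith [hv.2, hu.1]⟩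
          nlinarith
        have h2 : |(1 - t) * (z.1 - z.2.1)| = (1 - t) * |z.1 - z.2.1| := by
          rw [abs_mul, abs_of_nonneg (by linarith)]
        have h3 := abs_sub_abs_le_abs_sub ((1 - t) * (z.1 - z.2.1)) (t * (z.2.2 - u))
        linarith
    _ = _ := by simp

/-- The domination, uniform in `t`, that the reverse Fatou lemma requires. -/
theorem smoothKernel_le_logPos {t : ℝ} (ht : 0 < t) (ht2 : t ≤ 1 / 2) {z : ℝ × (ℝ × ℝ)}
    (hv : z.2.2 ∈ Icc (0 : ℝ) 1) :
    smoothKernel t z ≤ logPos z.1 z.2.1 + (ENNReal.ofReal (Real.log 4) + 2) := by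
  by_cases hne : z.1 = z.2.1
  · rw [hne, logPos_self]
    simp
  have hp : 0 < |z.1 - z.2.1| := abs_pos.2 (sub_ne_zero.2 hne)
  have key : ENNReal.ofReal (-Real.log (|z.1 - z.2.1| / 4)) ≤
      logPos z.1 z.2.1 + ENNReal.ofReal (Real.log 4) := by
    rw [logPos_of_ne hne, Real.log_div hp.ne' (by norm_num)]
    refine le_trans (le_of_eq ?_) ENNReal.ofReal_add_le
    congr 1
    ring
  rw [← add_assoc]
  -- With `d = |z.1 - z.2.1|`: in the first case `(1 - t) d - t ≥ (1 - t) d / 2 ≥ d / 4`; in the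
  -- second `d / 4 < t`, so the uniform bound `-log t + 2` suffices.
  by_cases h : 2 * t ≤ (1 - t) * |z.1 - z.2.1|
  · refine (smoothKernel_le_of_lt ht (by linarith) hv (by linarith)).trans ?_
    refine le_trans ?_ (key.trans le_self_add)
    refine ENNReal.ofReal_le_ofReal (neg_le_neg (Real.log_le_log (by positivity) ?_))
    nlinarith
  · refine (smoothKernel_le_log ht z).trans ?_
    gcongr
    refine le_trans ?_ key
    refine ENNReal.ofReal_le_ofReal (neg_le_neg (Real.log_le_log (by positivity) ?_))
    nlinarith

theorem limsup_smoothKernel_le {t : ℕ → ℝ} (ht : ∀ n, 0 < t n) (ht2 : ∀ n, t n ≤ 1 / 2)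
    (hlim : Tendsto t atTop (𝓝 0)) {z : ℝ × (ℝ × ℝ)} (hv : z.2.2 ∈ Icc (0 : ℝ) 1) :
    limsup (fun n => smoothKernel (t n) z) atTop ≤ logPos z.1 z.2.1 := by
  by_cases hne : z.1 = z.2.1
  · rw [hne, logPos_self]
    exact le_top
  have hp : 0 < |z.1 - z.2.1| := abs_pos.2 (sub_ne_zero.2 hne)
  have h1 : Tendsto (fun n => (1 - t n) * |z.1 - z.2.1| - t n) atTop (𝓝 |z.1 - z.2.1|) := by
    have := ((tendsto_const_nhds (x := (1 : ℝ))).sub hlim).mul_const |z.1 - z.2.1|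
    simpa using this.sub hlim
  have h2 : Tendsto (fun n => ENNReal.ofReal (-Real.log ((1 - t n) * |z.1 - z.2.1| - t n)))
      atTop (𝓝 (logPos z.1 z.2.1)) := by
    rw [logPos_of_ne hne]
    exact ENNReal.tendsto_ofReal ((h1.log hp.ne').neg)
  rw [← h2.limsup_eq]
  refine limsup_le_limsup ?_
  filter_upwards [h1.eventually (lt_mem_nhds hp)] with n hn
  exact smoothKernel_le_of_lt (ht n) (by linarith [ht2 n]) hv (by linarith)

/-- A measure of finite energy on the unit interval is approximated, in energy from above, by
absolutely continuous ones. -/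
theorem exists_absolutelyContinuous_mutualEnergy_le (ν : Measure ℝ) [IsProbabilityMeasure ν]
    (hν : ν (Icc 0 1)ᶜ = 0) (hE : mutualEnergy ν ν ≠ ∞) {ε : ℝ≥0∞} (hε : ε ≠ 0) :
    ∃ ν' : Measure ℝ, IsProbabilityMeasure ν' ∧ ν' ≪ volume ∧ ν' (Ioo 0 1)ᶜ = 0 ∧
      mutualEnergy ν' ν' ≤ mutualEnergy ν ν + ε := by
  let t : ℕ → ℝ := fun n => 1 / ((n : ℝ) + 2)
  have ht : ∀ n, 0 < t n := fun n => by positivity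
  have ht2 : ∀ n, t n ≤ 1 / 2 := fun n =>
    one_div_le_one_div_of_le (by norm_num) (by linarith [Nat.cast_nonneg (α := ℝ) n])
  have hlim : Tendsto t atTop (𝓝 0) :=
    tendsto_const_nhds.div_atTop (tendsto_atTop_add_const_right _ _ tendsto_natCast_atTop_atTop)
  have hv : ∀ᵐ z ∂(ν.prod (ν.prod (unif 0 1))), z.2.2 ∈ Icc (0 : ℝ) 1 :=
    Measure.quasiMeasurePreserving_snd.ae
      (Measure.quasiMeasurePreserving_snd.ae unif_mem_Icc)
  have hK : Measurable fun z : ℝ × (ℝ × ℝ) => logPos z.1 z.2.1 :=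
    measurable_logPos.comp (Measurable.prodMk (by fun_prop) (by fun_prop))
  have hint : ∫⁻ z, logPos z.1 z.2.1 ∂(ν.prod (ν.prod (unif 0 1))) = mutualEnergy ν ν := by
    rw [lintegral_prod_symm' _ hK, lintegral_prod _
      (by exact ((measurable_lintegral_logPos ν).comp measurable_fst).aemeasurable)]
    simp [mutualEnergy]
  have hlimsup : limsup (fun n => mutualEnergy (smoothing ν (t n)) (smoothing ν (t n))) atTop ≤
      mutualEnergy ν ν := by
    simp_rw [mutualEnergy_smoothing]
    -- Reverse Fatou; the dominating function is integrable because `ν` has finite energy.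
    refine (limsup_lintegral_le (fun z => logPos z.1 z.2.1 + (ENNReal.ofReal (Real.log 4) + 2))
      (fun n => measurable_smoothKernel (t n)) (fun n => ?_) ?_).trans ?_
    · filter_upwards [hv] with z hz using smoothKernel_le_logPos (ht n) (ht2 n) hz
    · rw [lintegral_add_left hK, hint]
      simp [hE]
    · rw [← hint]
      refine lintegral_mono_ae ?_
      filter_upwards [hv] with z hz using limsup_smoothKernel_le ht ht2 hlim hz
  obtain ⟨n, hn⟩ := (eventually_lt_of_limsup_lt
    (hlimsup.trans_lt (ENNReal.lt_add_right hE hε))).exists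
  exact ⟨smoothing ν (t n), inferInstance, smoothing_absolutelyContinuous ν (ht n).ne',
    smoothing_compl_Ioo ν hν (ht n) (by linarith [ht2 n]), hn.le⟩

/-! ### The truncated kernel -/

/-- The kernel `logPos` cut off at height `M`. -/
def truncLog (M : ℝ≥0) (x y : ℝ) : ℝ := (min (logPos x y) M).toReal

theorem min_logPos_ne_top (M : ℝ≥0) (x y : ℝ) : min (logPos x y) M ≠ ∞ :=
  ne_top_of_le_ne_top ENNReal.coe_ne_top (min_le_right _ _)

theorem truncLog_nonneg (M : ℝ≥0) (x y : ℝ) : 0 ≤ truncLog M x y := ENNReal.toReal_nonneg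

theorem ofReal_truncLog (M : ℝ≥0) (x y : ℝ) :
    ENNReal.ofReal (truncLog M x y) = min (logPos x y) M :=
  ENNReal.ofReal_toReal (min_logPos_ne_top M x y)

theorem truncLog_le (M : ℝ≥0) (x y : ℝ) : truncLog M x y ≤ M :=
  ENNReal.toReal_mono ENNReal.coe_ne_top (min_le_right _ _)

theorem continuous_truncLog (M : ℝ≥0) : Continuous fun p : ℝ × ℝ => truncLog M p.1 p.2 :=
  ENNReal.continuousOn_toReal.comp_continuous (continuous_logPos.min continuous_const)
    fun p => min_logPos_ne_top M p.1 p.2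

/-- The truncated kernel as a bounded continuous function. -/
def truncLogBCF (M : ℝ≥0) : ℝ × ℝ →ᵇ ℝ :=
  BoundedContinuousFunction.ofNormedAddCommGroup (fun p => truncLog M p.1 p.2)
    (continuous_truncLog M) M fun p => by
      rw [Real.norm_of_nonneg (truncLog_nonneg _ _ _)]
      exact truncLog_le _ _ _

theorem lintegral_min_logPos (M : ℝ≥0) (μ : Measure (ℝ × ℝ)) [IsFiniteMeasure μ] :
    ∫⁻ p, min (logPos p.1 p.2) M ∂μ = ENNReal.ofReal (∫ p, truncLog M p.1 p.2 ∂μ) := by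
  rw [ofReal_integral_eq_lintegral_ofReal (f := fun p : ℝ × ℝ => truncLog M p.1 p.2)
    ((truncLogBCF M).integrable μ) (Eventually.of_forall fun p => truncLog_nonneg _ _ _)]
  simp_rw [ofReal_truncLog]

/-- Energy is the supremum of the truncated energies. -/
theorem lintegral_logPos_le_of_forall_trunc {μ : Measure (ℝ × ℝ)} {C : ℝ≥0∞}
    (h : ∀ M : ℕ, ∫⁻ p, min (logPos p.1 p.2) ((M : ℝ≥0) : ℝ≥0∞) ∂μ ≤ C) :
    ∫⁻ p, logPos p.1 p.2 ∂μ ≤ C := by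
  have hsup : ∀ p : ℝ × ℝ, logPos p.1 p.2 =
      ⨆ M : ℕ, min (logPos p.1 p.2) ((M : ℝ≥0) : ℝ≥0∞) := fun p => by
    have : (⨆ M : ℕ, ((M : ℝ≥0) : ℝ≥0∞)) = ∞ := by simpa using ENNReal.iSup_natCast
    rw [← inf_iSup_eq, this]
    simp
  rw [lintegral_congr hsup, lintegral_iSup]
  · exact iSup_le h
  · exact fun M => measurable_logPos.min measurable_const
  · intro M N hMN p
    exact min_le_min le_rfl (by simpa using hMN)

theorem neg_log_abs_sub_nonneg {x y : ℝ} (hx : x ∈ Ioo (0 : ℝ) 1) (hy : y ∈ Ioo (0 : ℝ) 1) :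
    0 ≤ -Real.log |x - y| := by
  have : |x - y| ≤ 1 := abs_le.2 ⟨by linarith [hx.1, hy.2], by linarith [hx.2, hy.1]⟩
  linarith [Real.log_nonpos (abs_nonneg _) this]

theorem truncLog_le_neg_log {M : ℝ≥0} {x y : ℝ} (hx : x ∈ Ioo (0 : ℝ) 1)
    (hy : y ∈ Ioo (0 : ℝ) 1) (hne : x ≠ y) : truncLog M x y ≤ -Real.log |x - y| := by
  rw [truncLog, logPos_of_ne hne]
  exact (ENNReal.toReal_mono ENNReal.ofReal_ne_top (min_le_left _ _)).trans_eq
    (ENNReal.toReal_ofReal (neg_log_abs_sub_nonneg hx hy))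

/-- Truncation at height `-log δ` only affects pairs closer than `δ`. -/
theorem neg_log_le_truncLog_add {δ : ℝ} (hδ : 0 < δ) {x y : ℝ} (hx : x ∈ Ioo (0 : ℝ) 1)
    (hy : y ∈ Ioo (0 : ℝ) 1) (hne : x ≠ y) :
    -Real.log |x - y| ≤ truncLog (-Real.log δ).toNNReal x y +
      if |x - y| < δ then -Real.log |x - y| else 0 := by
  split_ifs with h
  · linarith [truncLog_nonneg (-Real.log δ).toNNReal x y]
  · rw [add_zero, truncLog, logPos_of_ne hne, min_eq_left,
      ENNReal.toReal_ofReal (neg_log_abs_sub_nonneg hx hy)]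
    exact ENNReal.ofReal_le_ofReal (neg_le_neg (Real.log_le_log hδ (not_lt.1 h)))

/-! ### The limit distribution of the centers -/

/-- The measure `φ dx` on the unit interval. -/
def densityMeasure (φ : ℝ → ℝ) : Measure ℝ :=
  (volume.restrict (Icc 0 1)).withDensity fun x => ENNReal.ofReal (φ x)

theorem integral_densityMeasure {c : ℕ → ℝ} {φ : ℝ → ℝ} (h : Distributed c φ) (f : ℝ → ℝ) :
    ∫ x, f x ∂(densityMeasure φ) = ∫ x in Icc (0 : ℝ) 1, f x * φ x := by
  rw [densityMeasure, integral_withDensity_eq_integral_toReal_smul₀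
    h.1.aestronglyMeasurable.aemeasurable.ennreal_ofReal
    (Eventually.of_forall fun _ => ENNReal.ofReal_lt_top)]
  refine integral_congr_ae ?_
  filter_upwards [h.2.1] with x hx
  rw [ENNReal.toReal_ofReal hx.le, smul_eq_mul, mul_comm]

/-- This is where `φ > 0` a.e. matters: it gives every absolutely continuous measure on `[0, 1]` a
density with respect to `φ dx`. -/
theorem volume_absolutelyContinuous_densityMeasure {c : ℕ → ℝ} {φ : ℝ → ℝ}
    (h : Distributed c φ) : volume.restrict (Icc 0 1) ≪ densityMeasure φ := by
  refine withDensity_absolutelyContinuous' h.1.aestronglyMeasurable.aemeasurable.ennreal_ofReal ?_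
  filter_upwards [h.2.1] with x hx
  simpa using hx

theorem card_block (n : ℕ) : (block n).card = n := by
  simp [block, two_mul]

theorem isProbabilityMeasure_densityMeasure {c : ℕ → ℝ} {φ : ℝ → ℝ} (h : Distributed c φ) :
    IsProbabilityMeasure (densityMeasure φ) := by
  have h1 := h.2.2 (fun _ => 1) continuousOn_const
  have h2 : Tendsto (fun n : ℕ => (∑ _k ∈ block n, (1 : ℝ)) / ((block n).card : ℝ)) atTop (𝓝 1) := by
    refine tendsto_const_nhds.congr' ?_
    filter_upwards [eventually_gt_atTop 0] with n hn
    have : ((block n).card : ℝ) ≠ 0 := by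
      rw [card_block]
      positivity
    simp [div_self this]
  have h3 := tendsto_nhds_unique h1 h2
  constructor
  rw [densityMeasure, withDensity_apply _ MeasurableSet.univ, Measure.restrict_univ,
    ← ofReal_integral_eq_lintegral_ofReal h.1 (h.2.1.mono fun x hx => hx.le)]
  simpa using h3

/-- The uniform probability measure on the centers with index in the block of `max n 1`. -/
def blockMeasure (c : ℕ → ℝ) (n : ℕ) : Measure ℝ :=
  ((max n 1 : ℕ) : ℝ≥0∞)⁻¹ • ∑ k ∈ block (max n 1), Measure.dirac (c k)

/-- The `max n 1` makes this hold also at `n = 0`, where the block is empty. -/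
instance instIsProbabilityMeasureBlockMeasure (c : ℕ → ℝ) (n : ℕ) :
    IsProbabilityMeasure (blockMeasure c n) := by
  constructor
  rw [blockMeasure, Measure.smul_apply, Measure.finsetSum_apply]
  simp only [measure_univ, Finset.sum_const, card_block, smul_eq_mul, nsmul_eq_mul, mul_one]
  exact ENNReal.inv_mul_cancel (by simp) (ENNReal.natCast_ne_top _)

theorem integral_blockMeasure (c : ℕ → ℝ) {n : ℕ} (hn : 0 < n) (f : ℝ → ℝ) :
    ∫ x, f x ∂(blockMeasure c n) = (∑ k ∈ block n, f (c k)) / n := by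
  rw [blockMeasure, max_eq_left hn, integral_smul_measure, integral_finsetSum_measure]
  · simp [div_eq_inv_mul]
  · intro k _
    exact integrable_dirac (by simp)

/-- A probability measure on the line as a point of the space of probability measures. -/
def toProb (μ : Measure ℝ) [IsProbabilityMeasure μ] : ProbabilityMeasure ℝ := ⟨μ, inferInstance⟩

@[simp]
theorem coe_toProb (μ : Measure ℝ) [IsProbabilityMeasure μ] : (toProb μ : Measure ℝ) = μ := rfl

theorem tendsto_blockMeasure {c : ℕ → ℝ} {φ : ℝ → ℝ} (h : Distributed c φ)
    [IsProbabilityMeasure (densityMeasure φ)] :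
    Tendsto (fun n => toProb (blockMeasure c n)) atTop (𝓝 (toProb (densityMeasure φ))) := by
  rw [ProbabilityMeasure.tendsto_iff_forall_integral_tendsto]
  intro f
  simp only [coe_toProb]
  rw [integral_densityMeasure h]
  refine (h.2.2 f f.continuous.continuousOn).congr' ?_
  filter_upwards [eventually_gt_atTop 0] with n hn
  rw [integral_blockMeasure c hn, card_block]

/-- Pairs of centers from two blocks are distributed with respect to the product measure, as both
blocks move to infinity. -/
theorem tendsto_block_pair {c : ℕ → ℝ} {φ : ℝ → ℝ} (h : Distributed c φ) (F : ℝ × ℝ →ᵇ ℝ) :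
    Tendsto (fun p : ℕ × ℕ => (∑ i ∈ block p.1, ∑ j ∈ block p.2, F (c i, c j)) /
        ((p.1 : ℝ) * p.2)) (atTop ×ˢ atTop)
      (𝓝 (∫ z, F z ∂((densityMeasure φ).prod (densityMeasure φ)))) := by
  have hΦ := isProbabilityMeasure_densityMeasure h
  have h1 := tendsto_blockMeasure h
  -- Weak convergence passes to products. The two block sizes tend to infinity independently, so one
  -- threshold later serves all pairs of blocks.
  have h2 := (ProbabilityMeasure.continuous_prod.tendsto
    (toProb (densityMeasure φ), toProb (densityMeasure φ))).comp
    ((h1.comp tendsto_fst).prodMk_nhds (h1.comp tendsto_snd))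
  have h3 := (ProbabilityMeasure.tendsto_iff_forall_integral_tendsto.1 h2) F
  simp only [Function.comp_apply, ProbabilityMeasure.toMeasure_prod, coe_toProb] at h3
  refine h3.congr' ?_
  filter_upwards [(eventually_gt_atTop 0).prod_mk (eventually_gt_atTop 0)] with p hp
  rw [integral_prod _ (F.integrable _), integral_blockMeasure c hp.1]
  simp_rw [integral_blockMeasure c hp.2]
  rw [← Finset.sum_div, div_div, mul_comm]

/-- The logarithms that enter the log-average spacing condition. -/
def nearLog (c : ℕ → ℝ) (δ : ℝ) (i j : ℕ) : ℝ :=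
  if i ≠ j ∧ |c i - c j| < δ then -Real.log |c i - c j| else 0

theorem nearLog_nonneg {c : ℕ → ℝ} (hc : ∀ k, c k ∈ Ioo (0 : ℝ) 1) (δ : ℝ) (i j : ℕ) :
    0 ≤ nearLog c δ i j := by
  unfold nearLog
  split_ifs
  · exact neg_log_abs_sub_nonneg (hc i) (hc j)
  · rfl

theorem sum_nearLog (c : ℕ → ℝ) (δ : ℝ) (m n : ℕ) :
    (∑ p ∈ (block m ×ˢ block n).filter (fun p => p.1 ≠ p.2 ∧ |c p.1 - c p.2| < δ),
        -Real.log |c p.1 - c p.2|) / ((block m ×ˢ block n).card : ℝ) =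
      (∑ i ∈ block m, ∑ j ∈ block n, nearLog c δ i j) / ((m : ℝ) * n) := by
  rw [Finset.sum_filter, Finset.sum_product, Finset.card_product, card_block, card_block]
  simp [nearLog]

theorem neg_log_le_truncLog_add_nearLog {c : ℕ → ℝ} (hc : ∀ k, c k ∈ Ioo (0 : ℝ) 1) {δ : ℝ}
    (hδ : 0 < δ) {i j : ℕ} (hij : i ≠ j) (hne : c i ≠ c j) :
    -Real.log |c i - c j| ≤ truncLog (-Real.log δ).toNNReal (c i) (c j) + nearLog c δ i j := by
  have := neg_log_le_truncLog_add hδ (hc i) (hc j) hne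
  simpa [nearLog, hij] using this

/-- The energy truncated at `M` is a limit of averages over pairs from a single block. The diagonal
contributes at most `M / n → 0`, and by A.2 with `ε = 1` the other pairs at most `L + 1`, a bound
independent of `M`. -/
theorem mutualEnergy_densityMeasure_ne_top {c : ℕ → ℝ} (hc : ∀ k, c k ∈ Ioo (0 : ℝ) 1)
    {φ : ℝ → ℝ} (h : Distributed c φ) {q : ℕ → ℕ} (hA2 : LogAverageSpacing c q) :
    mutualEnergy (densityMeasure φ) (densityMeasure φ) ≠ ∞ := by
  have hΦ := isProbabilityMeasure_densityMeasure h
  obtain ⟨δ, hδ, hev⟩ := hA2 1 one_pos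
  set L := (-Real.log δ).toNNReal
  suffices H : mutualEnergy (densityMeasure φ) (densityMeasure φ) ≤ ENNReal.ofReal (L + 1) from
    ne_top_of_le_ne_top ENNReal.ofReal_ne_top H
  rw [mutualEnergy_eq_prod]
  refine lintegral_logPos_le_of_forall_trunc fun M => ?_
  rw [lintegral_min_logPos]
  refine ENNReal.ofReal_le_ofReal ?_
  have hT := (tendsto_block_pair h (truncLogBCF (M : ℝ≥0))).comp
    (tendsto_id.prodMk (tendsto_id (x := (atTop : Filter ℕ))))
  have hT' : Tendsto (fun n : ℕ => (M : ℝ) * (n : ℝ)⁻¹ + (L + 1)) atTop (𝓝 ((M : ℝ) * 0 + (L + 1))) :=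
    (tendsto_inv_atTop_nhds_zero_nat.const_mul _).add_const _
  rw [mul_zero, zero_add] at hT'
  refine le_of_tendsto_of_tendsto hT hT' ?_
  filter_upwards [hev, eventually_gt_atTop 0] with n hn hn0
  obtain ⟨hne, hsum⟩ := hn 0 (Nat.zero_le _) 0 (Nat.zero_le _)
  rw [sum_nearLog] at hsum
  simp only [pow_zero, one_mul] at hne hsum
  have hn0' : (0 : ℝ) < n := by exact_mod_cast hn0
  have hpt : ∀ i ∈ block n, ∀ j ∈ block n, truncLog (M : ℝ≥0) (c i) (c j) ≤
      (if i = j then (M : ℝ) else 0) + (L + nearLog c δ i j) := fun i hi j hj => by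
    split_ifs with hij
    · have h1 : truncLog (M : ℝ≥0) (c i) (c j) ≤ M := by
        simpa using truncLog_le (M : ℝ≥0) (c i) (c j)
      have h2 := nearLog_nonneg hc δ i j
      have h3 : (0 : ℝ) ≤ L := L.2
      linarith
    · have h1 := truncLog_le_neg_log (M := (M : ℝ≥0)) (hc i) (hc j) (hne i hi j hj hij)
      have h2 := neg_log_le_truncLog_add_nearLog hc hδ hij (hne i hi j hj hij)
      have h3 := truncLog_le L (c i) (c j)
      linarith
  have hle : ∑ i ∈ block n, ∑ j ∈ block n, truncLog (M : ℝ≥0) (c i) (c j) ≤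
      n * M + (n * n * L + ∑ i ∈ block n, ∑ j ∈ block n, nearLog c δ i j) := by
    refine (Finset.sum_le_sum fun i hi => Finset.sum_le_sum fun j hj => hpt i hi j hj).trans_eq ?_
    simp only [Finset.sum_add_distrib, Finset.sum_const, card_block, nsmul_eq_mul,
      Finset.sum_ite_eq, Finset.sum_ite_mem, Finset.inter_self]
    ring
  change (∑ i ∈ block n, ∑ j ∈ block n, truncLog (M : ℝ≥0) (c i) (c j)) / ((n : ℝ) * n) ≤ _
  rw [div_le_iff₀ (by positivity)]
  rw [div_lt_iff₀ (by positivity)] at hsum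
  refine hle.trans ?_
  have : ((M : ℝ) * (n : ℝ)⁻¹ + (L + 1)) * (n * n) = n * M + (n * n * L + 1 * (n * n)) := by
    field_simp
  rw [this]
  linarith

/-! ### Discretization along the blocks -/

/-- The uniform probability measure on the middle half of the interval of index `k`. -/
def cell (c l : ℕ → ℝ) (k : ℕ) : Measure ℝ := unif (c k - l k / 4) (l k / 2)

theorem isProbabilityMeasure_cell (c : ℕ → ℝ) {l : ℕ → ℝ} {k : ℕ} (hl : 0 < l k) :
    IsProbabilityMeasure (cell c l k) :=
  isProbabilityMeasure_unif _ (by positivity)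

theorem cell_ae (c l : ℕ → ℝ) (k : ℕ) : ∀ᵐ x ∂(cell c l k), |x - c k| ≤ l k / 4 := by
  have : ∀ᵐ x ∂(cell c l k), x ∈ Icc (c k - l k / 4) (c k - l k / 4 + l k / 2) :=
    unif_compl _ _
  filter_upwards [this] with x hx
  exact abs_le.2 ⟨by linarith [hx.1], by linarith [hx.2]⟩

theorem mutualEnergy_cell_self_le (c : ℕ → ℝ) {l : ℕ → ℝ} {k : ℕ} (hl : 0 < l k) :
    mutualEnergy (cell c l k) (cell c l k) ≤ ENNReal.ofReal (-Real.log (l k / 2)) + 2 := by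
  have := isProbabilityMeasure_cell c hl
  calc mutualEnergy (cell c l k) (cell c l k)
      ≤ ∫⁻ _, (ENNReal.ofReal (-Real.log (l k / 2)) + 2) ∂(cell c l k) :=
        lintegral_mono fun y => lintegral_logPos_unif_le _ y (by positivity)
    _ = _ := by simp

theorem mutualEnergy_cell_le {c l : ℕ → ℝ} {i j : ℕ} (hi : 0 < l i) (hj : 0 < l j) {η : ℝ}
    (hne : c i ≠ c j) (h : (l i + l j) / (2 * |c i - c j|) < 1 - Real.exp (-η)) :
    mutualEnergy (cell c l i) (cell c l j) ≤ ENNReal.ofReal (-Real.log |c i - c j| + η) := by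
  have := isProbabilityMeasure_cell c hi
  have := isProbabilityMeasure_cell c hj
  have hp : 0 < |c i - c j| := abs_pos.2 (sub_ne_zero.2 hne)
  rw [div_lt_iff₀ (by positivity)] at h
  have e : -Real.log |c i - c j| + η = -Real.log (|c i - c j| * Real.exp (-η)) := by
    rw [Real.log_mul hp.ne' (Real.exp_pos _).ne', Real.log_exp]
    ring
  rw [e]
  calc mutualEnergy (cell c l i) (cell c l j)
      ≤ ∫⁻ _, ∫⁻ _, ENNReal.ofReal (-Real.log (|c i - c j| * Real.exp (-η)))
          ∂(cell c l i) ∂(cell c l j) := by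
        refine lintegral_mono_ae ?_
        filter_upwards [cell_ae c l j] with y hy
        refine lintegral_mono_ae ?_
        filter_upwards [cell_ae c l i] with x hx
        refine logPos_le_of_le (by positivity) ?_
        have h1 : |c i - c j| ≤ |x - y| + |x - c i| + |y - c j| := by
          have e1 : c i - c j = (x - y) - (x - c i) + (y - c j) := by ring
          calc |c i - c j| = |(x - y) - (x - c i) + (y - c j)| := by rw [← e1]
            _ ≤ |(x - y) - (x - c i)| + |y - c j| := abs_add_le _ _
            _ ≤ _ := by gcongr; exact abs_sub _ _
        -- Since `|x - c i| ≤ l i / 4` and `|y - c j| ≤ l j / 4`, `h` gives `|x - y| ≥ |c i - c j|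
        -- (1 + exp (-η)) / 2`; and `exp (-η) < 1`, because the quotient in `h` is positive.
        nlinarith
    _ = _ := by simp

theorem mutualEnergy_sum_le {ι : Type*} (S : Finset ι) {w : ι → ℝ} (hw : ∀ i, 0 ≤ w i)
    (μ : ι → Measure ℝ) [∀ i, SFinite (μ i)] {a : ι → ι → ℝ}
    (h : ∀ i ∈ S, ∀ j ∈ S, mutualEnergy (μ i) (μ j) ≤ ENNReal.ofReal (a i j)) :
    mutualEnergy (∑ i ∈ S, ENNReal.ofReal (w i) • μ i) (∑ i ∈ S, ENNReal.ofReal (w i) • μ i) ≤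
      ∑ j ∈ S, ∑ i ∈ S, ENNReal.ofReal (w i * w j * a i j) := by
  rw [mutualEnergy, lintegral_finsetSum_measure]
  refine Finset.sum_le_sum fun j hj => ?_
  rw [lintegral_smul_measure, smul_eq_mul]
  simp_rw [lintegral_finsetSum_measure, lintegral_smul_measure, smul_eq_mul]
  rw [lintegral_finsetSum _ fun i _ => (measurable_lintegral_logPos (μ i)).const_mul _,
    Finset.mul_sum]
  refine Finset.sum_le_sum fun i hi => ?_
  rw [lintegral_const_mul _ (measurable_lintegral_logPos (μ i)), ← mul_assoc,
    mul_comm (w i), ENNReal.ofReal_mul (mul_nonneg (hw j) (hw i)), ENNReal.ofReal_mul (hw j)]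
  gcongr
  exact h i hi j hj

/-- The indices of the blocks of `n, 2n, …, 2 ^ q * n`, tagged by the number of the block. -/
def blockIndex (n q : ℕ) : Finset (Σ _ : ℕ, ℕ) :=
  (Finset.range (q + 1)).sigma fun s => block (2 ^ s * n)

theorem mem_multiBlock_of_mem_blockIndex {n q : ℕ} {p : Σ _ : ℕ, ℕ} (h : p ∈ blockIndex n q) :
    p.2 ∈ multiBlock n q := by
  obtain ⟨h1, h2⟩ := Finset.mem_sigma.1 h
  exact Finset.mem_biUnion.2 ⟨p.1, h1, h2⟩

theorem le_of_mem_blockIndex {n q : ℕ} {p : Σ _ : ℕ, ℕ} (h : p ∈ blockIndex n q) : n ≤ p.2 := by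
  have h2 := (Finset.mem_Ico.1 (Finset.mem_sigma.1 h).2).1
  exact (Nat.le_mul_of_pos_left n (by positivity)).trans h2

/-- Each dyadic block ends where the next begins. Hence self-energies occur only within one block.
-/
theorem eq_of_mem_block {n s t i : ℕ} (h : i ∈ block (2 ^ s * n)) (h' : i ∈ block (2 ^ t * n)) :
    s = t := by
  have key : ∀ {s t : ℕ}, i ∈ block (2 ^ s * n) → i ∈ block (2 ^ t * n) → ¬ s < t := by
    intro s t h h' hst
    have h1 := (Finset.mem_Ico.1 h).2
    have h2 := (Finset.mem_Ico.1 h').1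
    have h3 : 2 ^ (s + 1) ≤ 2 ^ t := Nat.pow_le_pow_right (by norm_num) hst
    have h4 := Nat.mul_le_mul_right n h3
    rw [pow_succ] at h4
    have : 2 ^ s * 2 * n = 2 * (2 ^ s * n) := by ring
    omega
  exact le_antisymm (not_lt.1 (key h' h)) (not_lt.1 (key h h'))

/-- The weight of the index `p` in the discretization of `g`. -/
def weight (c : ℕ → ℝ) (g : ℝ → ℝ) (n q : ℕ) (p : Σ _ : ℕ, ℕ) : ℝ :=
  g (c p.2) / ((q + 1) * ((2 ^ p.1 * n : ℕ) : ℝ))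

/-- The discretization of the density `g` along the blocks of `n, 2n, …, 2 ^ q * n`. -/
def discretization (c l : ℕ → ℝ) (g : ℝ → ℝ) (n q : ℕ) : Measure ℝ :=
  ∑ p ∈ blockIndex n q, ENNReal.ofReal (weight c g n q p) • cell c l p.2

theorem discretization_absolutelyContinuous (c l : ℕ → ℝ) (g : ℝ → ℝ) (n q : ℕ) :
    discretization c l g n q ≪ volume := by
  intro A hA
  rw [discretization, Measure.finsetSum_apply]
  refine Finset.sum_eq_zero fun p _ => ?_
  rw [Measure.smul_apply, cell, unif_absolutelyContinuous _ _ hA, smul_zero]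

/-- A compact set that carries the discretization. -/
def carrier (c l : ℕ → ℝ) (g : ℝ → ℝ) (n q : ℕ) : Set ℝ :=
  ⋃ p ∈ (blockIndex n q).filter (fun p => g (c p.2) ≠ 0), Metric.closedBall (c p.2) (l p.2 / 4)

theorem isCompact_carrier (c l : ℕ → ℝ) (g : ℝ → ℝ) (n q : ℕ) : IsCompact (carrier c l g n q) :=
  Finset.isCompact_biUnion _ fun _ _ => isCompact_closedBall _ _

theorem discretization_compl_carrier (c l : ℕ → ℝ) (g : ℝ → ℝ) (n q : ℕ) :
    discretization c l g n q (carrier c l g n q)ᶜ = 0 := by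
  rw [discretization, Measure.finsetSum_apply]
  refine Finset.sum_eq_zero fun p hp => ?_
  rw [Measure.smul_apply]
  by_cases h : g (c p.2) = 0
  · simp [weight, h]
  · have : cell c l p.2 (carrier c l g n q)ᶜ = 0 := by
      change ∀ᵐ x ∂(cell c l p.2), x ∈ carrier c l g n q
      filter_upwards [cell_ae c l p.2] with x hx
      exact mem_biUnion (Finset.mem_filter.2 ⟨hp, h⟩) (by simpa [Real.dist_eq] using hx)
    rw [this, smul_zero]

theorem discretization_univ {c l : ℕ → ℝ} (hl : ∀ k, 0 < l k) {g : ℝ → ℝ} (hg : ∀ x, 0 ≤ g x)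
    (n q : ℕ) : discretization c l g n q univ = ENNReal.ofReal (∑ s ∈ Finset.range (q + 1),
      (∑ k ∈ block (2 ^ s * n), g (c k)) / ((2 ^ s * n : ℕ) : ℝ) / (q + 1)) := by
  have h1 : discretization c l g n q univ =
      ∑ p ∈ blockIndex n q, ENNReal.ofReal (weight c g n q p) := by
    rw [discretization, Measure.finsetSum_apply]
    refine Finset.sum_congr rfl fun p _ => ?_
    have := isProbabilityMeasure_cell c (hl p.2)
    simp
  have hw : ∀ p, 0 ≤ weight c g n q p := fun p => div_nonneg (hg _) (by positivity)
  rw [h1, ← ENNReal.ofReal_sum_of_nonneg fun p _ => hw p, blockIndex, Finset.sum_sigma]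
  congr 1
  refine Finset.sum_congr rfl fun s _ => ?_
  rw [div_div, Finset.sum_div]
  refine Finset.sum_congr rfl fun k _ => ?_
  rw [weight, mul_comm]

/-- The total mass is the mean over `s ≤ q n` of the block averages of `g`. As `2 ^ s * n ≥ n`, one
threshold from A.1 serves all of them, however large `q n` is. -/
theorem eventually_le_discretization_univ {c l : ℕ → ℝ} (hl : ∀ k, 0 < l k) {φ : ℝ → ℝ}
    (hA1 : Distributed c φ) {g : ℝ → ℝ} (hgc : Continuous g) (hg : ∀ x, 0 ≤ g x) (q : ℕ → ℕ)
    {η : ℝ} (hη : 0 < η) : ∀ᶠ n in atTop, ENNReal.ofReal (∫ x, g x ∂(densityMeasure φ) - η) ≤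
      discretization c l g n (q n) univ := by
  have h1 := hA1.2.2 g hgc.continuousOn
  rw [← integral_densityMeasure hA1] at h1
  obtain ⟨N, hN⟩ := eventually_atTop.1 (h1.eventually (lt_mem_nhds (sub_lt_self _ hη)))
  filter_upwards [eventually_ge_atTop N] with n hn
  rw [discretization_univ hl hg]
  refine ENNReal.ofReal_le_ofReal ?_
  have h2 : ∑ _s ∈ Finset.range (q n + 1), (∫ x, g x ∂(densityMeasure φ) - η) / ((q n : ℝ) + 1) =
      ∫ x, g x ∂(densityMeasure φ) - η := by
    rw [Finset.sum_const, Finset.card_range, nsmul_eq_mul]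
    push_cast
    field_simp
  rw [← h2]
  refine Finset.sum_le_sum fun s _ => ?_
  have h3 := hN (2 ^ s * n) (hn.trans (Nat.le_mul_of_pos_left n (by positivity)))
  rw [card_block] at h3
  gcongr

/-- The bound for the energies of two cells. -/
def cellBound (lam η : ℝ) (c : ℕ → ℝ) (i j : ℕ) : ℝ :=
  if i = j then lam * i + 4 else -Real.log |c i - c j| + η

theorem cellBound_le {lam η : ℝ} (hη : 0 ≤ η) {c : ℕ → ℝ} (hc : ∀ k, c k ∈ Ioo (0 : ℝ) 1)
    {δ : ℝ} (hδ : 0 < δ) {i j : ℕ} (hne : i ≠ j → c i ≠ c j) :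
    cellBound lam η c i j ≤ truncLog (-Real.log δ).toNNReal (c i) (c j) + nearLog c δ i j + η +
      if i = j then lam * i + 4 else 0 := by
  unfold cellBound
  split_ifs with h
  · have := truncLog_nonneg (-Real.log δ).toNNReal (c i) (c j)
    have := nearLog_nonneg hc δ i j
    linarith
  · linarith [neg_log_le_truncLog_add_nearLog hc hδ h (hne h)]

theorem mutualEnergy_cell_le_cellBound {lam : ℝ} (hlam : 0 < lam) {c l : ℕ → ℝ}
    (hl : ∀ k : ℕ, l k = Real.exp (-lam * (k : ℝ))) {η : ℝ} {i j : ℕ}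
    (h : i ≠ j → c i ≠ c j ∧ (l i + l j) / (2 * |c i - c j|) < 1 - Real.exp (-η)) :
    mutualEnergy (cell c l i) (cell c l j) ≤ ENNReal.ofReal (cellBound lam η c i j) := by
  have hpos : ∀ k, 0 < l k := fun k => by rw [hl]; exact Real.exp_pos _
  unfold cellBound
  split_ifs with hij
  · subst hij
    refine (mutualEnergy_cell_self_le c (hpos i)).trans ?_
    -- The `4` in `cellBound` covers `log 2`, from halving the interval, plus the `2` from unit
    -- scale.
    have h2 : Real.log 2 ≤ 2 := by linarith [Real.log_two_lt_d9]
    have h0 : 0 ≤ Real.log 2 := Real.log_nonneg (by norm_num)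
    have h1 : -Real.log (l i / 2) = lam * i + Real.log 2 := by
      rw [Real.log_div (hpos i).ne' (by norm_num), hl, Real.log_exp]
      ring
    have h3 : (2 : ℝ≥0∞) = ENNReal.ofReal 2 := by simp
    rw [h1, h3, ← ENNReal.ofReal_add (by positivity) (by norm_num)]
    exact ENNReal.ofReal_le_ofReal (by linarith)
  · exact mutualEnergy_cell_le (hpos i) (hpos j) (h hij).1 (h hij).2

/-- At most `N` indices, each at most `2N`, with self-energy linear in the index: the sum is
`O(N²)`. It is bounded but not small, hence the need for many blocks. -/
theorem sum_block_diagonal_le {lam : ℝ} (hlam : 0 < lam) {n s t : ℕ} (hn : 0 < n) :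
    (∑ i ∈ block (2 ^ s * n), ∑ j ∈ block (2 ^ t * n),
        if i = j then lam * (i : ℝ) + 4 else 0) / (((2 ^ s * n : ℕ) : ℝ) * ((2 ^ t * n : ℕ) : ℝ)) ≤
      if s = t then 2 * lam + 4 else 0 := by
  split_ifs with h
  · subst h
    set N := 2 ^ s * n
    have hN : (1 : ℝ) ≤ N := by
      have : 0 < N := by positivity
      exact_mod_cast this
    rw [div_le_iff₀ (by positivity)]
    calc ∑ i ∈ block N, ∑ j ∈ block N, (if i = j then lam * (i : ℝ) + 4 else 0)
        = ∑ i ∈ block N, (lam * (i : ℝ) + 4) := by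
          refine Finset.sum_congr rfl fun i hi => ?_
          rw [Finset.sum_ite_eq, if_pos hi]
      _ ≤ ∑ _i ∈ block N, (2 * lam + 4) * (N : ℝ) := by
          refine Finset.sum_le_sum fun i hi => ?_
          have h1 : (i : ℝ) ≤ 2 * N := by exact_mod_cast (Finset.mem_Ico.1 hi).2.le
          nlinarith
      _ = _ := by
          rw [Finset.sum_const, card_block, nsmul_eq_mul]
          ring
  · refine le_of_eq ?_
    rw [Finset.sum_eq_zero, zero_div]
    intro i hi
    refine Finset.sum_eq_zero fun j hj => if_neg ?_
    rintro rfl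
    exact h (eq_of_mem_block hi hj)

/-- The kernel `g(x) g(y) truncLog M x y` as a bounded continuous function. -/
def weightedKernel (M : ℝ≥0) {g : ℝ → ℝ} {B : ℝ} (hgc : Continuous g) (hg : ∀ x, 0 ≤ g x)
    (hB : ∀ x, g x ≤ B) : ℝ × ℝ →ᵇ ℝ :=
  BoundedContinuousFunction.ofNormedAddCommGroup (fun p => g p.1 * g p.2 * truncLog M p.1 p.2)
    (by have := continuous_truncLog M; fun_prop) (B * B * M) fun p => by
      have h0 := truncLog_nonneg M p.1 p.2
      have hB0 : 0 ≤ B := (hg 0).trans (hB 0)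
      rw [Real.norm_of_nonneg (mul_nonneg (mul_nonneg (hg _) (hg _)) h0)]
      exact mul_le_mul (mul_le_mul (hB _) (hB _) (hg _) hB0) (truncLog_le _ _ _) h0 (by positivity)

theorem ofReal_integral_weightedKernel_le (M : ℝ≥0) {g : ℝ → ℝ} {B : ℝ} (hgc : Continuous g)
    (hg : ∀ x, 0 ≤ g x) (hB : ∀ x, g x ≤ B) (Φ : Measure ℝ) [IsProbabilityMeasure Φ] :
    ENNReal.ofReal (∫ z, weightedKernel M hgc hg hB z ∂(Φ.prod Φ)) ≤
      mutualEnergy (Φ.withDensity fun x => ENNReal.ofReal (g x))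
        (Φ.withDensity fun x => ENNReal.ofReal (g x)) := by
  have hm : Measurable fun x => ENNReal.ofReal (g x) := hgc.measurable.ennreal_ofReal
  rw [ofReal_integral_eq_lintegral_ofReal ((weightedKernel M hgc hg hB).integrable _)
    (Eventually.of_forall fun p => mul_nonneg (mul_nonneg (hg _) (hg _)) (truncLog_nonneg _ _ _)),
    lintegral_prod_symm' _ (weightedKernel M hgc hg hB).continuous.measurable.ennreal_ofReal,
    mutualEnergy, lintegral_withDensity_eq_lintegral_mul _ hm (measurable_lintegral_logPos _)]
  refine lintegral_mono fun y => ?_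
  simp only [Pi.mul_apply]
  rw [lintegral_withDensity_eq_lintegral_mul _ hm (measurable_logPos_left y),
    ← lintegral_const_mul _ (hm.mul (measurable_logPos_left y))]
  refine lintegral_mono fun x => ?_
  change ENNReal.ofReal (g x * g y * truncLog M x y) ≤
    ENNReal.ofReal (g y) * (ENNReal.ofReal (g x) * logPos x y)
  rw [mul_comm (g x), ENNReal.ofReal_mul (mul_nonneg (hg y) (hg x)), ENNReal.ofReal_mul (hg y),
    mul_assoc, ofReal_truncLog]
  gcongr
  exact min_le_left _ _

/-- The energy of the discretization of `g` is asymptotically at most that of `g φ dx`. -/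
theorem eventually_mutualEnergy_discretization_le {lam : ℝ} (hlam : 0 < lam)
    {c : ℕ → ℝ} (hc : ∀ k, c k ∈ Ioo (0 : ℝ) 1)
    {l : ℕ → ℝ} (hl : ∀ k : ℕ, l k = Real.exp (-lam * (k : ℝ)))
    {φ : ℝ → ℝ} (hA1 : Distributed c φ) {q : ℕ → ℕ} (hq : Tendsto q atTop atTop)
    (hA2 : LogAverageSpacing c q) (hA3 : GapControl c l q)
    {g : ℝ → ℝ} {B : ℝ} (hgc : Continuous g) (hg : ∀ x, 0 ≤ g x) (hB : ∀ x, g x ≤ B)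
    {ε : ℝ} (hε : 0 < ε) :
    ∀ᶠ n in atTop, mutualEnergy (discretization c l g n (q n)) (discretization c l g n (q n)) ≤
      mutualEnergy ((densityMeasure φ).withDensity fun x => ENNReal.ofReal (g x))
        ((densityMeasure φ).withDensity fun x => ENNReal.ofReal (g x)) + ENNReal.ofReal ε := by
  have hΦ := isProbabilityMeasure_densityMeasure hA1
  have hpos : ∀ k, 0 < l k := fun k => by rw [hl]; exact Real.exp_pos _
  have hB0 : 0 ≤ B := (hg 0).trans (hB 0)
  -- One `η` is spent on the convergence of the block sums; `B * B * η` is spent twice, on near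
  -- pairs (A.2) and on replacing cells by centers (A.3). The other `ε / 2` is for the diagonal.
  obtain ⟨η, hη, hηε⟩ : ∃ η : ℝ, 0 < η ∧ η + 2 * (B * B * η) ≤ ε / 2 := by
    refine ⟨ε / 2 / (1 + 2 * (B * B)), by positivity, le_of_eq ?_⟩
    field_simp
  obtain ⟨δ, hδ, hev2⟩ := hA2 η hη
  set M := (-Real.log δ).toNNReal
  set F := weightedKernel M hgc hg hB
  set IF := ∫ z, F z ∂((densityMeasure φ).prod (densityMeasure φ))
  have hF := tendsto_block_pair hA1 F
  have hF' := hF.eventually (gt_mem_nhds (lt_add_of_pos_right IF hη))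
  obtain ⟨N, hN⟩ := eventually_atTop.1 (by simpa only [prod_atTop_atTop_eq] using hF')
  have hdiag : Tendsto (fun n => B * B * (2 * lam + 4) / ((q n : ℝ) + 1)) atTop (𝓝 0) :=
    tendsto_const_nhds.div_atTop
      (tendsto_atTop_add_const_right _ _ (tendsto_natCast_atTop_atTop.comp hq))
  have hexp : 0 < 1 - Real.exp (-η) := by
    have := Real.exp_lt_one_iff.2 (neg_lt_zero.2 hη)
    linarith
  filter_upwards [hev2, hA3 _ hexp, eventually_ge_atTop (max N.1 N.2), eventually_gt_atTop 0,
    hdiag.eventually (gt_mem_nhds (half_pos hε))] with n h2 h3 hnN hn0 hd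
  set Q := q n
  have hw : ∀ p, 0 ≤ weight c g n Q p := fun p => div_nonneg (hg _) (by positivity)
  have hsf : ∀ p : Σ _ : ℕ, ℕ, SFinite (cell c l p.2) := fun p => by
    have := isProbabilityMeasure_cell c (hpos p.2)
    infer_instance
  have hnn : ∀ i j, 0 ≤ cellBound lam η c i j := fun i j => by
    unfold cellBound
    split_ifs
    · positivity
    · exact add_nonneg (neg_log_abs_sub_nonneg (hc i) (hc j)) hη.le
  have hmain := mutualEnergy_sum_le (blockIndex n Q) hw (fun p => cell c l p.2)
    (a := fun p p' => cellBound lam η c p.2 p'.2) fun p hp p' hp' =>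
      mutualEnergy_cell_le_cellBound hlam hl (h3 _ (mem_multiBlock_of_mem_blockIndex hp) _
        (mem_multiBlock_of_mem_blockIndex hp'))
  refine hmain.trans ?_
  have hterm : ∀ p p' : Σ _ : ℕ, ℕ,
      0 ≤ weight c g n Q p * weight c g n Q p' * cellBound lam η c p.2 p'.2 := fun p p' =>
    mul_nonneg (mul_nonneg (hw p) (hw p')) (hnn _ _)
  have hreal : ∑ p' ∈ blockIndex n Q, ∑ p ∈ blockIndex n Q,
      weight c g n Q p * weight c g n Q p' * cellBound lam η c p.2 p'.2 ≤ IF + ε := by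
    rw [Finset.sum_comm, blockIndex, Finset.sum_sigma]
    have hpair : ∀ s ∈ Finset.range (Q + 1), ∀ t ∈ Finset.range (Q + 1),
        ∑ i ∈ block (2 ^ s * n), ∑ j ∈ block (2 ^ t * n),
          weight c g n Q ⟨s, i⟩ * weight c g n Q ⟨t, j⟩ * cellBound lam η c i j ≤
        (IF + η + 2 * (B * B * η) + if s = t then B * B * (2 * lam + 4) else 0) /
          (((Q : ℝ) + 1) * (Q + 1)) := by
      intro s hs t ht
      have hsQ : s ≤ Q := Nat.lt_succ_iff.1 (Finset.mem_range.1 hs)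
      have htQ : t ≤ Q := Nat.lt_succ_iff.1 (Finset.mem_range.1 ht)
      obtain ⟨hne, hnear⟩ := h2 s hsQ t htQ
      rw [sum_nearLog] at hnear
      have hdg := sum_block_diagonal_le hlam (s := s) (t := t) hn0
      have hs1 : n ≤ 2 ^ s * n := Nat.le_mul_of_pos_left n (by positivity)
      have ht1 : n ≤ 2 ^ t * n := Nat.le_mul_of_pos_left n (by positivity)
      have hFst := hN (2 ^ s * n, 2 ^ t * n) ⟨(le_max_left _ _).trans (hnN.trans hs1),
        (le_max_right _ _).trans (hnN.trans ht1)⟩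
      simp only at hFst
      set S := 2 ^ s * n
      set T := 2 ^ t * n
      have hS : (0 : ℝ) < S := by
        have : 0 < S := hn0.trans_le hs1
        exact_mod_cast this
      have hT : (0 : ℝ) < T := by
        have : 0 < T := hn0.trans_le ht1
        exact_mod_cast this
      have hQ : (0 : ℝ) < (Q : ℝ) + 1 := by positivity
      have hpt : ∀ i ∈ block S, ∀ j ∈ block T, g (c i) * g (c j) * cellBound lam η c i j ≤
          F (c i, c j) + B * B * nearLog c δ i j + B * B * η +
            B * B * (if i = j then lam * (i : ℝ) + 4 else 0) := by
        intro i hi j hj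
        have h4 := cellBound_le (lam := lam) hη.le hc hδ (hne i hi j hj)
        have h5 : g (c i) * g (c j) ≤ B * B := mul_le_mul (hB _) (hB _) (hg _) hB0
        have h6 : 0 ≤ g (c i) * g (c j) := mul_nonneg (hg _) (hg _)
        have h7 := nearLog_nonneg hc δ i j
        have h8 : 0 ≤ (if i = j then lam * (i : ℝ) + 4 else 0) := by
          split_ifs <;> positivity
        have h9 : F (c i, c j) = g (c i) * g (c j) * truncLog M (c i) (c j) := rfl
        rw [h9]
        refine (mul_le_mul_of_nonneg_left h4 h6).trans ?_
        have a1 := mul_le_mul_of_nonneg_right h5 h7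
        have a2 := mul_le_mul_of_nonneg_right h5 hη.le
        have a3 := mul_le_mul_of_nonneg_right h5 h8
        linarith
      have hsum := Finset.sum_le_sum fun i hi => Finset.sum_le_sum fun j hj => hpt i hi j hj
      simp only [Finset.sum_add_distrib, ← Finset.mul_sum, Finset.sum_const, card_block,
        nsmul_eq_mul] at hsum
      have hfac : ∑ i ∈ block S, ∑ j ∈ block T,
          weight c g n Q ⟨s, i⟩ * weight c g n Q ⟨t, j⟩ * cellBound lam η c i j =
          (∑ i ∈ block S, ∑ j ∈ block T, g (c i) * g (c j) * cellBound lam η c i j) /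
            ((S : ℝ) * T) / (((Q : ℝ) + 1) * (Q + 1)) := by
        simp only [Finset.sum_div]
        refine Finset.sum_congr rfl fun i _ => Finset.sum_congr rfl fun j _ => ?_
        simp only [weight]
        change g (c i) / (((Q : ℝ) + 1) * S) * (g (c j) / (((Q : ℝ) + 1) * T)) * _ = _
        field_simp
      rw [hfac]
      refine div_le_div_of_nonneg_right ?_ (by positivity)
      refine (div_le_div_of_nonneg_right hsum (by positivity)).trans ?_
      rw [add_div, add_div, add_div, mul_div_assoc (B * B), mul_div_assoc (B * B),
        mul_div_assoc (B * B)]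
      have e1 : (T : ℝ) * (S * η) / (S * T) = η := by field_simp
      have e2 : B * B * (if s = t then 2 * lam + 4 else 0) =
          if s = t then B * B * (2 * lam + 4) else 0 := by split_ifs <;> simp
      have hBB : 0 ≤ B * B := mul_nonneg hB0 hB0
      have a1 := mul_le_mul_of_nonneg_left hnear.le hBB
      have a2 := mul_le_mul_of_nonneg_left hdg hBB
      rw [e2] at a2
      rw [e1]
      linarith
    calc ∑ s ∈ Finset.range (Q + 1), ∑ i ∈ block (2 ^ s * n),
          ∑ p' ∈ (Finset.range (Q + 1)).sigma fun s => block (2 ^ s * n),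
            weight c g n Q ⟨s, i⟩ * weight c g n Q p' * cellBound lam η c i p'.2
        = ∑ s ∈ Finset.range (Q + 1), ∑ t ∈ Finset.range (Q + 1), ∑ i ∈ block (2 ^ s * n),
            ∑ j ∈ block (2 ^ t * n),
            weight c g n Q ⟨s, i⟩ * weight c g n Q ⟨t, j⟩ * cellBound lam η c i j := by
          refine Finset.sum_congr rfl fun s _ => ?_
          rw [Finset.sum_comm]
          simp only [Finset.sum_sigma]
          refine Finset.sum_congr rfl fun t _ => ?_
          rw [Finset.sum_comm]
      _ ≤ ∑ s ∈ Finset.range (Q + 1), ∑ t ∈ Finset.range (Q + 1),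
          (IF + η + 2 * (B * B * η) + if s = t then B * B * (2 * lam + 4) else 0) /
            (((Q : ℝ) + 1) * (Q + 1)) :=
          Finset.sum_le_sum fun s hs => Finset.sum_le_sum fun t ht => hpair s hs t ht
      _ = IF + (η + 2 * (B * B * η)) + B * B * (2 * lam + 4) / ((Q : ℝ) + 1) := by
          -- Only `Q + 1` of the `(Q + 1)²` pairs of blocks have `s = t`, so after normalization the
          -- diagonal gains the factor `1 / (Q + 1)`.
          have hdd : ∑ s ∈ Finset.range (Q + 1), ∑ t ∈ Finset.range (Q + 1),
              (if s = t then B * B * (2 * lam + 4) else 0) =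
              ((Q : ℝ) + 1) * (B * B * (2 * lam + 4)) := by
            rw [Finset.sum_congr rfl fun s hs => by rw [Finset.sum_ite_eq, if_pos hs]]
            simp
          simp only [← Finset.sum_div]
          simp only [Finset.sum_add_distrib, hdd, Finset.sum_const, Finset.card_range,
            nsmul_eq_mul]
          push_cast
          field_simp
          ring
      _ ≤ IF + ε := by linarith
  have hIF : ENNReal.ofReal (IF + ε) ≤ ENNReal.ofReal IF + ENNReal.ofReal ε :=
    ENNReal.ofReal_add_le
  calc ∑ p' ∈ blockIndex n Q, ∑ p ∈ blockIndex n Q,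
        ENNReal.ofReal (weight c g n Q p * weight c g n Q p' * cellBound lam η c p.2 p'.2)
      = ENNReal.ofReal (∑ p' ∈ blockIndex n Q, ∑ p ∈ blockIndex n Q,
        weight c g n Q p * weight c g n Q p' * cellBound lam η c p.2 p'.2) := by
        rw [ENNReal.ofReal_sum_of_nonneg fun p' _ => Finset.sum_nonneg fun p _ => hterm p p']
        refine Finset.sum_congr rfl fun p' _ => ?_
        rw [ENNReal.ofReal_sum_of_nonneg fun p _ => hterm p p']
    _ ≤ ENNReal.ofReal IF + ENNReal.ofReal ε := (ENNReal.ofReal_le_ofReal hreal).trans hIF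
    _ ≤ _ := by
        gcongr
        exact ofReal_integral_weightedKernel_le M hgc hg hB _

/-! ### Approximation by continuous densities -/

theorem mutualEnergy_withDensity (Φ : Measure ℝ) [IsFiniteMeasure Φ] {a : ℝ → ℝ}
    (ha : Measurable a) :
    mutualEnergy (Φ.withDensity fun x => ENNReal.ofReal (a x))
        (Φ.withDensity fun x => ENNReal.ofReal (a x)) =
      ∫⁻ p, ENNReal.ofReal (a p.1) * ENNReal.ofReal (a p.2) * logPos p.1 p.2 ∂(Φ.prod Φ) := by
  have hm : Measurable fun x => ENNReal.ofReal (a x) := ha.ennreal_ofReal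
  have hmm : Measurable fun p : ℝ × ℝ =>
      ENNReal.ofReal (a p.1) * ENNReal.ofReal (a p.2) * logPos p.1 p.2 :=
    ((hm.comp measurable_fst).mul (hm.comp measurable_snd)).mul measurable_logPos
  rw [lintegral_prod_symm' _ hmm, mutualEnergy,
    lintegral_withDensity_eq_lintegral_mul _ hm (measurable_lintegral_logPos _)]
  refine lintegral_congr fun y => ?_
  simp only [Pi.mul_apply]
  rw [lintegral_withDensity_eq_lintegral_mul _ hm (measurable_logPos_left y),
    ← lintegral_const_mul _ (hm.mul (measurable_logPos_left y))]
  refine lintegral_congr fun x => ?_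
  simp only [Pi.mul_apply]
  ring

/-- Perturbing a bounded density changes the energy by at most an integral against the
potential. -/
theorem mutualEnergy_withDensity_le_add (Φ : Measure ℝ) [IsFiniteMeasure Φ] {a b : ℝ → ℝ}
    (ha : Measurable a) (hb : Measurable b) (ha0 : ∀ x, 0 ≤ a x) (hb0 : ∀ x, 0 ≤ b x) {M : ℝ}
    (haM : ∀ x, a x ≤ M) (hbM : ∀ x, b x ≤ M) :
    mutualEnergy (Φ.withDensity fun x => ENNReal.ofReal (b x))
        (Φ.withDensity fun x => ENNReal.ofReal (b x)) ≤
      mutualEnergy (Φ.withDensity fun x => ENNReal.ofReal (a x))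
        (Φ.withDensity fun x => ENNReal.ofReal (a x)) +
      ENNReal.ofReal (2 * M) * ∫⁻ y, ENNReal.ofReal |b y - a y| * ∫⁻ x, logPos x y ∂Φ ∂Φ := by
  have hM : 0 ≤ M := (ha0 0).trans (haM 0)
  have hd : Measurable fun x => ENNReal.ofReal |b x - a x| :=
    ((hb.sub ha).norm).ennreal_ofReal
  have m1 : Measurable fun p : ℝ × ℝ => ENNReal.ofReal |b p.2 - a p.2| * logPos p.1 p.2 :=
    (hd.comp measurable_snd).mul measurable_logPos
  have h1 : ∫⁻ p, ENNReal.ofReal |b p.2 - a p.2| * logPos p.1 p.2 ∂(Φ.prod Φ) =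
      ∫⁻ y, ENNReal.ofReal |b y - a y| * ∫⁻ x, logPos x y ∂Φ ∂Φ := by
    rw [lintegral_prod_symm' _ m1]
    exact lintegral_congr fun y =>
      lintegral_const_mul (ENNReal.ofReal |b y - a y|) (measurable_logPos_left y)
  have h2 : ∫⁻ p, ENNReal.ofReal |b p.1 - a p.1| * logPos p.1 p.2 ∂(Φ.prod Φ) =
      ∫⁻ y, ENNReal.ofReal |b y - a y| * ∫⁻ x, logPos x y ∂Φ ∂Φ := by
    rw [← h1, ← lintegral_prod_swap]
    simp [logPos_comm]
  rw [mutualEnergy_withDensity Φ ha, mutualEnergy_withDensity Φ hb]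
  -- With `x = p.1`, `y = p.2`: `b(x) b(y) - a(x) a(y) = b(x) (b(y) - a(y)) + a(y) (b(x) - a(x))`.
  have hpt : ∀ p : ℝ × ℝ, ENNReal.ofReal (b p.1) * ENNReal.ofReal (b p.2) * logPos p.1 p.2 ≤
      ENNReal.ofReal (a p.1) * ENNReal.ofReal (a p.2) * logPos p.1 p.2 +
      (ENNReal.ofReal M * (ENNReal.ofReal |b p.2 - a p.2| * logPos p.1 p.2) +
        ENNReal.ofReal M * (ENNReal.ofReal |b p.1 - a p.1| * logPos p.1 p.2)) := by
    intro p
    rw [← mul_assoc, ← mul_assoc, ← add_mul, ← add_mul]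
    refine mul_le_mul_left ?_ _
    rw [← ENNReal.ofReal_mul (hb0 _), ← ENNReal.ofReal_mul (ha0 _), ← ENNReal.ofReal_mul hM,
      ← ENNReal.ofReal_mul hM, ← ENNReal.ofReal_add (by positivity) (by positivity),
      ← ENNReal.ofReal_add (mul_nonneg (ha0 _) (ha0 _)) (by positivity)]
    refine ENNReal.ofReal_le_ofReal ?_
    have e1 := le_abs_self (b p.2 - a p.2)
    have e2 := le_abs_self (b p.1 - a p.1)
    have e3 := abs_nonneg (b p.2 - a p.2)
    have e4 := abs_nonneg (b p.1 - a p.1)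
    have e5 := mul_le_mul_of_nonneg_left e1 (hb0 p.1)
    have e6 := mul_le_mul_of_nonneg_left e2 (ha0 p.2)
    have e7 := mul_le_mul_of_nonneg_right (hbM p.1) e3
    have e8 := mul_le_mul_of_nonneg_right (haM p.2) e4
    linarith
  refine (lintegral_mono hpt).trans_eq ?_
  have hm : Measurable fun x => ENNReal.ofReal (a x) := ha.ennreal_ofReal
  have m0 : Measurable fun p : ℝ × ℝ =>
      ENNReal.ofReal (a p.1) * ENNReal.ofReal (a p.2) * logPos p.1 p.2 :=
    ((hm.comp measurable_fst).mul (hm.comp measurable_snd)).mul measurable_logPos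
  have m2 : Measurable fun p : ℝ × ℝ => ENNReal.ofReal |b p.1 - a p.1| * logPos p.1 p.2 :=
    (hd.comp measurable_fst).mul measurable_logPos
  rw [lintegral_add_left m0, lintegral_add_left (m1.const_mul _), lintegral_const_mul _ m1,
    lintegral_const_mul _ m2, h1, h2, ← add_mul, ← ENNReal.ofReal_add hM hM, two_mul]

/-- A bounded density supported in a compact subset of an open set `U` is approximated by
continuous ones with compact support in `U`, both in mass and in energy. -/
theorem exists_continuous_density {Φ : Measure ℝ} [IsFiniteMeasure Φ]
    (hΦ : mutualEnergy Φ Φ ≠ ∞) {F U : Set ℝ} (hF : IsCompact F) (hU : IsOpen U) (hFU : F ⊆ U)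
    {a : ℝ → ℝ} (ha : Measurable a) (ha0 : ∀ x, 0 ≤ a x) {M : ℝ} (haM : ∀ x, a x ≤ M)
    (haF : ∀ x ∉ F, a x = 0) {η : ℝ} (hη : 0 < η) :
    ∃ g : ℝ → ℝ, Continuous g ∧ (∀ x, 0 ≤ g x) ∧ (∀ x, g x ≤ M) ∧ IsCompact (tsupport g) ∧
      tsupport g ⊆ U ∧
      ∫⁻ x, ENNReal.ofReal (a x) ∂Φ ≤ ∫⁻ x, ENNReal.ofReal (g x) ∂Φ + ENNReal.ofReal η ∧
      mutualEnergy (Φ.withDensity fun x => ENNReal.ofReal (g x))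
          (Φ.withDensity fun x => ENNReal.ofReal (g x)) ≤
        mutualEnergy (Φ.withDensity fun x => ENNReal.ofReal (a x))
          (Φ.withDensity fun x => ENNReal.ofReal (a x)) + ENNReal.ofReal η := by
  have hM : 0 ≤ M := (ha0 0).trans (haM 0)
  set P : ℝ → ℝ≥0∞ := fun y => ∫⁻ x, logPos x y ∂Φ with hP
  have hPm : Measurable P := measurable_lintegral_logPos Φ
  -- Closeness in `L¹(Θ)` controls mass through the weight `1` and energy through the potential `P`;
  -- `Θ` is finite because `Φ` has finite energy.
  set Θ : Measure ℝ := Φ.withDensity fun y => 1 + P y with hΘ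
  have hΘm : Measurable fun y => 1 + P y := measurable_const.add hPm
  have hΘfin : IsFiniteMeasure Θ := by
    refine isFiniteMeasure_withDensity ?_
    rw [lintegral_add_left measurable_const]
    have : ∫⁻ y, P y ∂Φ ≠ ∞ := hΦ
    simpa using this
  have haint : Integrable a Θ := by
    refine Integrable.of_bound ha.aestronglyMeasurable M (Eventually.of_forall fun x => ?_)
    rw [Real.norm_of_nonneg (ha0 x)]
    exact haM x
  -- Chosen so that both `κ ≤ η` and `2 * M * κ ≤ η`.
  set κ : ℝ := η / (1 + 2 * M) with hκ
  have hκ0 : 0 < κ := by positivity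
  obtain ⟨h, hh, -⟩ := haint.exists_boundedContinuous_lintegral_sub_le
    (ε := ENNReal.ofReal κ) (by simpa using hκ0)
  obtain ⟨χ, hχ1, hχc, hχU, hχ⟩ := exists_continuousMap_one_of_isCompact_subset_isOpen hF hU hFU
  -- Clamping to `[0, M]` and multiplying by the cutoff do not increase the distance to `a`, which
  -- takes values in `[0, M]` and vanishes off `F`, where `χ` need not be `1`.
  set g : ℝ → ℝ := fun x => χ x * min (max (h x) 0) M with hg
  have hgc : Continuous g :=
    χ.continuous.mul ((h.continuous.max continuous_const).min continuous_const)
  have hcl0 : ∀ x, 0 ≤ min (max (h x) 0) M := fun x => le_min (le_max_right _ _) hM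
  have hg0 : ∀ x, 0 ≤ g x := fun x => mul_nonneg (hχ x).1 (hcl0 x)
  have hgM : ∀ x, g x ≤ M := fun x =>
    (mul_le_of_le_one_left (hcl0 x) (hχ x).2).trans (min_le_right _ _)
  have hts : tsupport g ⊆ tsupport χ := tsupport_mul_subset_left
  have hdist : ∀ x, |g x - a x| ≤ |a x - h x| := by
    intro x
    have h1 : |min (max (h x) 0) M - a x| ≤ |a x - h x| := by
      rw [abs_sub_comm (a x)]
      have h2 : a x = min (max (a x) 0) M := by
        rw [max_eq_left (ha0 x), min_eq_left (haM x)]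
      calc |min (max (h x) 0) M - a x| = |min (max (h x) 0) M - min (max (a x) 0) M| := by
            rw [← h2]
        _ ≤ max |max (h x) 0 - max (a x) 0| |M - M| := abs_min_sub_min_le_max _ _ _ _
        _ = |max (h x) 0 - max (a x) 0| := by simp
        _ ≤ _ := abs_max_sub_max_le_abs _ _ _
    refine le_trans ?_ h1
    by_cases hx : x ∈ F
    · have : χ x = 1 := hχ1 hx
      simp [hg, this]
    · rw [haF x hx, sub_zero, sub_zero, abs_of_nonneg (hg0 x), abs_of_nonneg (hcl0 x)]
      exact mul_le_of_le_one_left (hcl0 x) (hχ x).2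
  have hD : ∫⁻ x, ENNReal.ofReal |g x - a x| ∂Θ ≤ ENNReal.ofReal κ := by
    refine le_trans (lintegral_mono fun x => ?_) hh
    rw [Real.enorm_eq_ofReal_abs]
    exact ENNReal.ofReal_le_ofReal (hdist x)
  have hdm : Measurable fun x => ENNReal.ofReal |g x - a x| :=
    ((hgc.measurable.sub ha).norm).ennreal_ofReal
  rw [hΘ, lintegral_withDensity_eq_lintegral_mul _ hΘm hdm] at hD
  have hD1 : ∫⁻ x, ENNReal.ofReal |g x - a x| ∂Φ ≤ ENNReal.ofReal κ := by
    refine le_trans (lintegral_mono fun x => ?_) hD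
    exact le_mul_of_one_le_left' le_self_add
  have hD2 : ∫⁻ x, ENNReal.ofReal |g x - a x| * P x ∂Φ ≤ ENNReal.ofReal κ := by
    refine le_trans (lintegral_mono fun x => ?_) hD
    simp only [Pi.mul_apply]
    rw [mul_comm]
    exact mul_le_mul_left le_add_self _
  refine ⟨g, hgc, hg0, hgM, hχc.of_isClosed_subset (isClosed_tsupport g) hts, hts.trans hχU, ?_, ?_⟩
  · calc ∫⁻ x, ENNReal.ofReal (a x) ∂Φ
        ≤ ∫⁻ x, (ENNReal.ofReal (g x) + ENNReal.ofReal |g x - a x|) ∂Φ := by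
          refine lintegral_mono fun x => ?_
          rw [← ENNReal.ofReal_add (hg0 x) (abs_nonneg _)]
          refine ENNReal.ofReal_le_ofReal ?_
          have := neg_abs_le (g x - a x)
          linarith
      _ = ∫⁻ x, ENNReal.ofReal (g x) ∂Φ + ∫⁻ x, ENNReal.ofReal |g x - a x| ∂Φ :=
          lintegral_add_right _ hdm
      _ ≤ _ := by
          gcongr
          refine hD1.trans (ENNReal.ofReal_le_ofReal ?_)
          exact div_le_self hη.le (by linarith)
  · refine (mutualEnergy_withDensity_le_add Φ ha hgc.measurable ha0 hg0 haM hgM).trans ?_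
    gcongr
    calc ENNReal.ofReal (2 * M) * ∫⁻ y, ENNReal.ofReal |g y - a y| * P y ∂Φ
        ≤ ENNReal.ofReal (2 * M) * ENNReal.ofReal κ := by gcongr
      _ = ENNReal.ofReal (2 * M * κ) := (ENNReal.ofReal_mul (by positivity)).symm
      _ ≤ ENNReal.ofReal η := by
          refine ENNReal.ofReal_le_ofReal ?_
          rw [hκ, mul_div_assoc', div_le_iff₀ (by positivity)]
          nlinarith

/-- A probability measure carried by an open set `U` and absolutely continuous with respect to `Φ`
is approximated by measures with continuous densities compactly supported in `U`. -/
theorem exists_continuous_density_of_absolutelyContinuous {Φ : Measure ℝ} [IsFiniteMeasure Φ]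
    (hΦ : mutualEnergy Φ Φ ≠ ∞) {U : Set ℝ} (hU : IsOpen U) {ν : Measure ℝ}
    [IsProbabilityMeasure ν] (hν : ν ≪ Φ) (hνU : ν Uᶜ = 0) {η : ℝ} (hη : 0 < η) :
    ∃ (g : ℝ → ℝ) (B : ℝ), Continuous g ∧ (∀ x, 0 ≤ g x) ∧ (∀ x, g x ≤ B) ∧
      IsCompact (tsupport g) ∧ tsupport g ⊆ U ∧ 1 - η ≤ ∫ x, g x ∂Φ ∧
      mutualEnergy (Φ.withDensity fun x => ENNReal.ofReal (g x))
          (Φ.withDensity fun x => ENNReal.ofReal (g x)) ≤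
        mutualEnergy ν ν + ENNReal.ofReal η := by
  have hν1 : ENNReal.ofReal (1 - η / 2) < ν U := by
    rw [(prob_compl_eq_zero_iff hU.measurableSet).1 hνU]
    exact ENNReal.ofReal_lt_one.2 (by linarith)
  obtain ⟨F, hFU, hF, hνF⟩ := hU.exists_lt_isCompact hν1
  set ρ := ν.rnDeriv Φ
  have hρm : Measurable ρ := Measure.measurable_rnDeriv ν Φ
  have hρ : Φ.withDensity ρ = ν := Measure.withDensity_rnDeriv_eq ν Φ hν
  -- Monotone convergence: truncating the density at a large `M` loses little mass.
  have hmass : ν F = ⨆ M : ℕ, ∫⁻ x in F, min (ρ x) (M : ℝ≥0∞) ∂Φ := by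
    rw [← hρ, withDensity_apply _ hF.measurableSet, ← lintegral_iSup]
    · refine lintegral_congr fun x => ?_
      rw [← inf_iSup_eq, ENNReal.iSup_natCast]
      simp
    · exact fun M => hρm.min measurable_const
    · intro M N hMN x
      exact min_le_min le_rfl (by exact_mod_cast hMN)
  rw [hmass] at hνF
  obtain ⟨M, hM⟩ := lt_iSup_iff.1 hνF
  set a : ℝ → ℝ := F.indicator fun x => (min (ρ x) (M : ℝ≥0∞)).toReal with ha_def
  have hfin : ∀ x, min (ρ x) (M : ℝ≥0∞) ≠ ∞ := fun x =>
    ne_top_of_le_ne_top (ENNReal.natCast_ne_top M) (min_le_right _ _)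
  have ha : Measurable a :=
    ((hρm.min measurable_const).ennreal_toReal).indicator hF.measurableSet
  have ha0 : ∀ x, 0 ≤ a x := fun x => indicator_nonneg (fun _ _ => ENNReal.toReal_nonneg) x
  have hofa : ∀ x, ENNReal.ofReal (a x) = F.indicator (fun x => min (ρ x) (M : ℝ≥0∞)) x := by
    intro x
    by_cases hx : x ∈ F
    · simp [ha_def, hx, ENNReal.ofReal_toReal (hfin x)]
    · simp [ha_def, hx]
  have haM : ∀ x, a x ≤ M := by
    intro x
    by_cases hx : x ∈ F
    · rw [ha_def, indicator_of_mem hx]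
      exact ENNReal.toReal_le_of_le_ofReal (by positivity) (by simp)
    · rw [ha_def, indicator_of_notMem hx]
      positivity
  obtain ⟨g, hgc, hg0, hgM, hgs, hgU, hgm, hgE⟩ := exists_continuous_density hΦ hF hU hFU ha ha0 haM
    (fun x hx => indicator_of_notMem hx _) (half_pos hη)
  refine ⟨g, M, hgc, hg0, hgM, hgs, hgU, ?_, hgE.trans ?_⟩
  · have hgint : Integrable g Φ := by
      refine Integrable.of_bound hgc.aestronglyMeasurable M (Eventually.of_forall fun x => ?_)
      rw [Real.norm_of_nonneg (hg0 x)]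
      exact hgM x
    simp_rw [hofa] at hgm
    rw [lintegral_indicator hF.measurableSet, ← ofReal_integral_eq_lintegral_ofReal hgint
      (Eventually.of_forall hg0), ← ENNReal.ofReal_add (integral_nonneg hg0) (by positivity)] at hgm
    have h1 := (ENNReal.ofReal_lt_ofReal_iff'.1 (hM.trans_le hgm)).1
    linarith
  -- The truncated density gives a measure below `ν`, so its energy is no larger.
  · refine add_le_add (mutualEnergy_mono ?_ ?_) (ENNReal.ofReal_le_ofReal (by linarith)) <;>
    · conv_rhs => rw [← hρ]
      refine withDensity_mono (Eventually.of_forall fun x => ?_)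
      simp only [hofa]
      exact indicator_le' (fun y _ => min_le_left _ _) (fun y _ => zero_le) x

/-! ### One step of the construction -/

theorem tendsto_length {lam : ℝ} (hlam : 0 < lam) {l : ℕ → ℝ}
    (hl : ∀ k : ℕ, l k = Real.exp (-lam * (k : ℝ))) : Tendsto l atTop (𝓝 0) := by
  have h1 : Tendsto (fun k : ℕ => -lam * (k : ℝ)) atTop atBot :=
    tendsto_natCast_atTop_atTop.const_mul_atTop_of_neg (neg_lt_zero.2 hlam)
  exact (Real.tendsto_exp_atBot.comp h1).congr fun k => (hl k).symm

/-- Only cells with `g (c k) ≠ 0` are kept, so their centers lie in the support of `g`. Their radii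
tend to `0`, and a closed thickening of the compact support still fits in `U`. -/
theorem carrier_subset {lam : ℝ} (hlam : 0 < lam) {c l : ℕ → ℝ}
    (hl : ∀ k : ℕ, l k = Real.exp (-lam * (k : ℝ))) {g : ℝ → ℝ} (hgs : IsCompact (tsupport g))
    {U : Set ℝ} (hU : IsOpen U) (hgU : tsupport g ⊆ U) (q : ℕ → ℕ) (m : ℕ) :
    ∀ᶠ n in atTop, carrier c l g n (q n) ⊆ U ∩ ⋃ k : ℕ, ⋃ _ : m ≤ k, interval c l k := by
  obtain ⟨r, hr, hrU⟩ := hgs.exists_cthickening_subset_open hU hgU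
  obtain ⟨N, hN⟩ := eventually_atTop.1
    ((tendsto_length hlam hl).eventually (gt_mem_nhds hr))
  filter_upwards [eventually_ge_atTop (max m N)] with n hn x hx
  obtain ⟨p, hp, hxp⟩ := mem_iUnion₂.1 hx
  obtain ⟨hp1, hp2⟩ := Finset.mem_filter.1 hp
  have hnp := hn.trans (le_of_mem_blockIndex hp1)
  have hpos : 0 < l p.2 := by rw [hl]; exact Real.exp_pos _
  have hlr := hN p.2 ((le_max_right _ _).trans hnp)
  refine ⟨hrU ?_, ?_⟩
  · refine Metric.mem_cthickening_of_dist_le x (c p.2) r _ (subset_tsupport g hp2) ?_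
    have : dist x (c p.2) ≤ l p.2 / 4 := hxp
    linarith
  · refine mem_iUnion₂.2 ⟨p.2, (le_max_left _ _).trans hnp, ?_⟩
    rw [Metric.mem_closedBall, Real.dist_eq, abs_le] at hxp
    exact ⟨by linarith [hxp.1], by linarith [hxp.2]⟩

/-- The continuous approximation and the discretization each cost `η` in mass and `η` in energy.
Normalizing a mass of at least `1 - 2η` multiplies the energy by at most `(1 - 2η)⁻²`; let `η → 0`.
-/
theorem exists_normalization_error {E ε : ℝ≥0∞} (hE : E ≠ ∞) (hε : ε ≠ 0) :
    ∃ η : ℝ, 0 < η ∧ η < 1 / 2 ∧ (ENNReal.ofReal (1 - 2 * η))⁻¹ * (ENNReal.ofReal (1 - 2 * η))⁻¹ *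
      (E + ENNReal.ofReal (2 * η)) ≤ E + ε := by
  have h1 : Tendsto (fun η : ℝ => (ENNReal.ofReal (1 - 2 * η))⁻¹) (𝓝[>] 0) (𝓝 1) := by
    have : Tendsto (fun η : ℝ => 1 - 2 * η) (𝓝[>] 0) (𝓝 (1 - 2 * 0)) :=
      ((Continuous.tendsto (by fun_prop) 0).mono_left nhdsWithin_le_nhds)
    have := (ENNReal.tendsto_ofReal this).inv
    simpa using this
  have h2 : Tendsto (fun η : ℝ => E + ENNReal.ofReal (2 * η)) (𝓝[>] 0) (𝓝 E) := by
    have : Tendsto (fun η : ℝ => 2 * η) (𝓝[>] 0) (𝓝 (2 * 0)) :=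
      ((Continuous.tendsto (by fun_prop) 0).mono_left nhdsWithin_le_nhds)
    have := (ENNReal.tendsto_ofReal this).const_add E
    simpa using this
  have h3 := ENNReal.Tendsto.mul (ENNReal.Tendsto.mul h1 (Or.inl one_ne_zero) h1
    (Or.inl one_ne_zero)) (Or.inl (by simp)) h2 (Or.inr (by simp))
  rw [one_mul, one_mul] at h3
  have h4 := h3.eventually (gt_mem_nhds (ENNReal.lt_add_right hE hε))
  obtain ⟨η, h5, h6, h7⟩ := (h4.and ((eventually_mem_nhdsWithin).and
    (eventually_nhdsWithin_of_eventually_nhds (gt_mem_nhds (one_half_pos (α := ℝ)))))).exists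
  exact ⟨η, h6, h7, h5.le⟩

/-- Every absolutely continuous measure carried by an open subset `U` of the unit interval can be
replaced, at a small cost in energy, by one carried by a compact subset of `U ∩ ⋃_{k ≥ m} I_k`. -/
theorem exists_measure_on_intervals {lam : ℝ} (hlam : 0 < lam)
    {c : ℕ → ℝ} (hc : ∀ k, c k ∈ Ioo (0 : ℝ) 1)
    {l : ℕ → ℝ} (hl : ∀ k : ℕ, l k = Real.exp (-lam * (k : ℝ)))
    {φ : ℝ → ℝ} (hA1 : Distributed c φ) {q : ℕ → ℕ} (hq : Tendsto q atTop atTop)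
    (hA2 : LogAverageSpacing c q) (hA3 : GapControl c l q)
    {U : Set ℝ} (hU : IsOpen U) (hU1 : U ⊆ Icc 0 1) {ν : Measure ℝ} [IsProbabilityMeasure ν]
    (hν : ν ≪ volume) (hνU : ν Uᶜ = 0) (hE : mutualEnergy ν ν ≠ ∞) {ε : ℝ≥0∞} (hε : ε ≠ 0)
    (m : ℕ) :
    ∃ (ν' : Measure ℝ) (F : Set ℝ), IsProbabilityMeasure ν' ∧ ν' ≪ volume ∧ IsCompact F ∧
      ν' Fᶜ = 0 ∧ F ⊆ U ∩ (⋃ k : ℕ, ⋃ _ : m ≤ k, interval c l k) ∧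
      mutualEnergy ν' ν' ≤ mutualEnergy ν ν + ε := by
  have hΦ := isProbabilityMeasure_densityMeasure hA1
  have hpos : ∀ k, 0 < l k := fun k => by rw [hl]; exact Real.exp_pos _
  have hνΦ : ν ≪ densityMeasure φ := by
    refine Measure.AbsolutelyContinuous.trans ?_ (volume_absolutelyContinuous_densityMeasure hA1)
    have h1 : ν.restrict (Icc 0 1) = ν :=
      Measure.restrict_eq_self_of_ae_mem (measure_mono_null (compl_subset_compl.2 hU1) hνU)
    rw [← h1]
    exact hν.restrict _
  obtain ⟨η, hη, hη2, hηE⟩ := exists_normalization_error hE hε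
  obtain ⟨g, B, hgc, hg0, hgB, hgs, hgU, hgm, hgE⟩ :=
    exists_continuous_density_of_absolutelyContinuous
      (mutualEnergy_densityMeasure_ne_top hc hA1 hA2) hU hνΦ hνU hη
  obtain ⟨n, h1, h2, h3⟩ := ((eventually_mutualEnergy_discretization_le hlam hc hl hA1 hq hA2 hA3
    hgc hg0 hgB hη).and ((eventually_le_discretization_univ hpos hA1 hgc hg0 q hη).and
      (carrier_subset hlam hl hgs hU hgU q m))).exists
  set μ := discretization c l g n (q n)
  have hmass : ENNReal.ofReal (1 - 2 * η) ≤ μ univ :=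
    (ENNReal.ofReal_le_ofReal (by linarith)).trans h2
  have hmass0 : μ univ ≠ 0 := by
    have h4 : 0 < ENNReal.ofReal (1 - 2 * η) := ENNReal.ofReal_pos.2 (by linarith)
    exact (h4.trans_le hmass).ne'
  have hmasst : μ univ ≠ ∞ := by
    rw [discretization_univ hpos hg0]
    exact ENNReal.ofReal_ne_top
  have : IsFiniteMeasure μ := ⟨hmasst.lt_top⟩
  refine ⟨(μ univ)⁻¹ • μ, carrier c l g n (q n), ?_, ?_, isCompact_carrier _ _ _ _ _, ?_, h3, ?_⟩
  · constructor
    rw [Measure.smul_apply, smul_eq_mul, ENNReal.inv_mul_cancel hmass0 hmasst]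
  · exact Measure.smul_absolutelyContinuous.trans (discretization_absolutelyContinuous _ _ _ _ _)
  · rw [Measure.smul_apply, discretization_compl_carrier, smul_zero]
  · rw [mutualEnergy_smul]
    refine le_trans ?_ hηE
    have hinv := ENNReal.inv_le_inv.2 hmass
    gcongr
    refine (h1.trans (add_le_add_left hgE _)).trans_eq ?_
    rw [add_assoc, ← ENNReal.ofReal_add hη.le hη.le, two_mul]

/-! ### Passing to the limit -/

/-- The energy is lower semicontinuous for weak convergence. -/
theorem mutualEnergy_le_of_tendsto {ι : Type*} {f : Filter ι} [f.NeBot]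
    {μ : ι → ProbabilityMeasure ℝ} {μ' : ProbabilityMeasure ℝ} (h : Tendsto μ f (𝓝 μ'))
    {C : ℝ≥0∞} (hC : ∀ i, mutualEnergy (μ i : Measure ℝ) (μ i : Measure ℝ) ≤ C) :
    mutualEnergy (μ' : Measure ℝ) (μ' : Measure ℝ) ≤ C := by
  rw [mutualEnergy_eq_prod]
  -- Each truncated kernel is bounded and continuous, so its integral passes to the weak limit of
  -- the product measures.
  refine lintegral_logPos_le_of_forall_trunc fun M => ?_
  rw [lintegral_min_logPos]
  have h2 := (ProbabilityMeasure.continuous_prod.tendsto (μ', μ')).comp (h.prodMk_nhds h)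
  have h3 := (ProbabilityMeasure.tendsto_iff_forall_integral_tendsto.1 h2) (truncLogBCF (M : ℝ≥0))
  refine le_of_tendsto (ENNReal.tendsto_ofReal h3) (Eventually.of_forall fun i => ?_)
  simp only [Function.comp_apply, ProbabilityMeasure.toMeasure_prod]
  refine le_trans (le_of_eq (lintegral_min_logPos (M : ℝ≥0) _).symm) ?_
  refine le_trans (lintegral_mono fun p => min_le_left _ _) ?_
  rw [← mutualEnergy_eq_prod]
  exact hC i

/-- A sequence of probability measures carried by closed sets that decrease inside a compact set
has a weak limit point; it is carried by the intersection, and energy bounds pass to it. -/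
theorem exists_measure_iInter {μ : ℕ → Measure ℝ} (hμ : ∀ n, IsProbabilityMeasure (μ n))
    {K : ℕ → Set ℝ} (hK : ∀ n, IsCompact (K n)) (hanti : Antitone K)
    (hμK : ∀ n, μ n (K n)ᶜ = 0) {C : ℝ≥0∞} (hC : ∀ n, mutualEnergy (μ n) (μ n) ≤ C) :
    ∃ μ' : Measure ℝ, IsProbabilityMeasure μ' ∧ μ' (⋂ n, K n)ᶜ = 0 ∧ mutualEnergy μ' μ' ≤ C := by
  set P : ℕ → ProbabilityMeasure ℝ := fun n => toProb (μ n) with hP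
  have hμK' : ∀ m n, m ≤ n → μ n (K m)ᶜ = 0 := fun m n hmn =>
    measure_mono_null (compl_subset_compl.2 (hanti hmn)) (hμK n)
  have htight : IsTightMeasureSet {((ν : ProbabilityMeasure ℝ) : Measure ℝ) | ν ∈ range P} := by
    rw [isTightMeasureSet_iff_exists_isCompact_measure_compl_le]
    intro ε _
    refine ⟨K 0, hK 0, ?_⟩
    rintro _ ⟨_, ⟨n, rfl⟩, rfl⟩
    simp [hP, hμK' 0 n (Nat.zero_le n)]
  have hcomp := isCompact_closure_of_isTightMeasureSet htight
  -- All measures are carried by `K 0`, so Prokhorov gives compactness; a hyperfilter limit takes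
  -- the place of a subsequence.
  obtain ⟨μ', -, hμ'⟩ := hcomp.ultrafilter_le_nhds ((hyperfilter ℕ).map P) (by
    rw [le_principal_iff]
    exact Filter.mem_map.2 (Filter.univ_mem' fun n => subset_closure (mem_range_self n)))
  have hT : Tendsto P (hyperfilter ℕ : Filter ℕ) (𝓝 μ') := hμ'
  refine ⟨μ', inferInstance, ?_, mutualEnergy_le_of_tendsto hT hC⟩
  rw [compl_iInter]
  refine measure_iUnion_null fun m => ?_
  -- Portmanteau for the open set `(K m)ᶜ`, which is null for all measures from `m` on.
  have h1 := ProbabilityMeasure.le_liminf_measure_open_of_tendsto hT (hK m).isClosed.isOpen_compl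
  have h2 : Tendsto (fun n => (P n : Measure ℝ) (K m)ᶜ) (hyperfilter ℕ : Filter ℕ) (𝓝 0) := by
    refine tendsto_const_nhds.congr' ?_
    have h3 : ∀ᶠ n in (hyperfilter ℕ : Filter ℕ), m ≤ n :=
      Nat.hyperfilter_le_atTop (eventually_ge_atTop m)
    filter_upwards [h3] with n hn
    exact (hμK' m n hn).symm
  rw [h2.liminf_eq] at h1
  exact le_antisymm h1 zero_le

/-! ### Iterating the construction -/

/-- An absolutely continuous probability measure of finite energy, carried by an open subset of the
unit interval. -/
structure Stage where
  /-- the measure -/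
  ν : Measure ℝ
  /-- the open set -/
  U : Set ℝ
  prob : IsProbabilityMeasure ν
  ac : ν ≪ volume
  isOpen : IsOpen U
  subset : U ⊆ Icc 0 1
  carried : ν Uᶜ = 0
  finite : mutualEnergy ν ν ≠ ∞

/-- The compact carrier is thickened to an open set with compact closure in the same region:
openness lets the step be repeated, and the closures form the nested compact sets. -/
theorem Stage.exists_next {lam : ℝ} (hlam : 0 < lam)
    {c : ℕ → ℝ} (hc : ∀ k, c k ∈ Ioo (0 : ℝ) 1)
    {l : ℕ → ℝ} (hl : ∀ k : ℕ, l k = Real.exp (-lam * (k : ℝ)))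
    {φ : ℝ → ℝ} (hA1 : Distributed c φ) {q : ℕ → ℕ} (hq : Tendsto q atTop atTop)
    (hA2 : LogAverageSpacing c q) (hA3 : GapControl c l q)
    {ε : ℕ → ℝ≥0∞} (hε : ∀ m, 0 < ε m) (hεt : ∀ m, ε m ≠ ∞) (m : ℕ) (s : Stage) :
    ∃ s' : Stage, IsCompact (closure s'.U) ∧
      closure s'.U ⊆ s.U ∩ (⋃ k : ℕ, ⋃ _ : m ≤ k, interval c l k) ∧
      mutualEnergy s'.ν s'.ν ≤ mutualEnergy s.ν s.ν + ε m := by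
  have := s.prob
  obtain ⟨ν', F, hp, hac, hF, hνF, hFU, hE⟩ := exists_measure_on_intervals hlam hc hl hA1 hq hA2 hA3
    s.isOpen s.subset s.ac s.carried s.finite (hε m).ne' m
  have hopen : IsOpen (s.U ∩ (⋃ k : ℕ, ⋃ _ : m ≤ k, interval c l k)) :=
    s.isOpen.inter (isOpen_iUnion fun k => isOpen_iUnion fun _ => isOpen_Ioo)
  obtain ⟨V, hV, hFV, hVU, hVc⟩ := exists_open_between_and_isCompact_closure hF hopen hFU
  exact ⟨⟨ν', V, hp, hac, hV, fun x hx => s.subset (hVU (subset_closure hx)).1,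
    measure_mono_null (compl_subset_compl.2 hFV) hνF,
    ne_top_of_le_ne_top (ENNReal.add_ne_top.2 ⟨s.finite, hεt m⟩) hE⟩, hVc, hVU, hE⟩

/-- Probability measures on the unit interval are approximated, in energy from above, by measures
carried by a compact subset of the limsup set. -/
theorem exists_measure_on_limsup {lam : ℝ} (hlam : 0 < lam)
    {c : ℕ → ℝ} (hc : ∀ k, c k ∈ Ioo (0 : ℝ) 1)
    {l : ℕ → ℝ} (hl : ∀ k : ℕ, l k = Real.exp (-lam * (k : ℝ)))
    {φ : ℝ → ℝ} (hA1 : Distributed c φ) {q : ℕ → ℕ} (hq : Tendsto q atTop atTop)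
    (hA2 : LogAverageSpacing c q) (hA3 : GapControl c l q)
    {ν : Measure ℝ} [IsProbabilityMeasure ν] (hν : ν (Icc 0 1)ᶜ = 0)
    (hE : mutualEnergy ν ν ≠ ∞) {ε : ℝ≥0∞} (hε : ε ≠ 0) :
    ∃ (μ : Measure ℝ) (F : Set ℝ), IsProbabilityMeasure μ ∧ IsCompact F ∧
      F ⊆ ⋂ m : ℕ, ⋃ k : ℕ, ⋃ _ : m ≤ k, interval c l k ∧ μ Fᶜ = 0 ∧
      mutualEnergy μ μ ≤ mutualEnergy ν ν + ε := by
  obtain ⟨e, he0, het, hesum⟩ : ∃ e : ℕ → ℝ≥0∞, (∀ m, 0 < e m) ∧ (∀ m, e m ≠ ∞) ∧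
      ∑' m, e m ≤ ε / 2 := by
    obtain ⟨e, h1, h2⟩ := ENNReal.exists_pos_sum_of_countable' (ε := ε / 2) (by simpa using hε) ℕ
    exact ⟨e, h1, fun m => ne_top_of_le_ne_top h2.ne_top (ENNReal.le_tsum m), h2.le⟩
  obtain ⟨ν₀, hp, hac, hcar, hE₀⟩ :=
    -- Half of `ε` pays for smoothing, half for the iteration. The minimum with `1` keeps the energy
    -- finite when `ε = ∞`.
    exists_absolutelyContinuous_mutualEnergy_le ν hν hE (ε := min (ε / 2) 1)
      (by simpa [min_eq_bot] using hε)
  let s₀ : Stage := ⟨ν₀, Ioo 0 1, hp, hac, isOpen_Ioo, Ioo_subset_Icc_self, hcar,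
    ne_top_of_le_ne_top (ENNReal.add_ne_top.2
      ⟨hE, ne_top_of_le_ne_top ENNReal.one_ne_top (min_le_right _ _)⟩) hE₀⟩
  choose next hnext1 hnext2 hnext3 using
    Stage.exists_next hlam hc hl hA1 hq hA2 hA3 he0 het
  let seq : ℕ → Stage := fun n => Nat.rec s₀ next n
  have hseqE : ∀ n, mutualEnergy (seq n).ν (seq n).ν ≤
      mutualEnergy ν₀ ν₀ + ∑ m ∈ Finset.range n, e m := by
    intro n
    induction n with
    | zero => simp [seq, s₀]
    | succ n ih =>
      rw [Finset.sum_range_succ, ← add_assoc]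
      exact (hnext3 n (seq n)).trans (add_le_add_left ih _)
  have hK : ∀ n, IsCompact (closure (seq (n + 1)).U) := fun n => hnext1 n (seq n)
  have hsub : ∀ n, closure (seq (n + 1)).U ⊆
      (seq n).U ∩ (⋃ k : ℕ, ⋃ _ : n ≤ k, interval c l k) := fun n => hnext2 n (seq n)
  have hanti : Antitone fun n => closure (seq (n + 1)).U :=
    antitone_nat_of_succ_le fun n x hx => subset_closure (hsub (n + 1) hx).1
  -- The shift to `n + 1` drops the initial set `(0, 1)`; the closure at stage `n + 1` lies in `⋃_{k
  -- ≥ n} I_k`.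
  obtain ⟨μ, hμ, hμK, hμE⟩ := exists_measure_iInter (fun n => (seq (n + 1)).prob) hK hanti
    (fun n => measure_mono_null (compl_subset_compl.2 subset_closure) (seq (n + 1)).carried)
    (C := mutualEnergy ν ν + ε) (fun n => by
      refine (hseqE (n + 1)).trans ?_
      calc mutualEnergy ν₀ ν₀ + ∑ m ∈ Finset.range (n + 1), e m
          ≤ (mutualEnergy ν ν + ε / 2) + ε / 2 :=
            add_le_add (hE₀.trans (add_le_add_right (min_le_left _ _) _))
              ((ENNReal.sum_le_tsum _).trans hesum)
        _ = _ := by rw [add_assoc, ENNReal.add_halves])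
  refine ⟨μ, ⋂ n, closure (seq (n + 1)).U, hμ,
    (hK 0).of_isClosed_subset (isClosed_iInter fun n => isClosed_closure) (iInter_subset _ 0),
    iInter_mono fun m x hx => (hsub m hx).2, hμK, hμE⟩

/-! ### Measures on the plane carried by the unit interval -/

theorem toENNReal_logKernel_ofReal (x y : ℝ) : (logKernel x y).toENNReal = logPos x y := by
  rw [logKernel, logPos, Complex.isometry_ofReal.edist_eq]

theorem measurableEmbedding_ofReal : MeasurableEmbedding (Complex.ofReal) :=
  Complex.isometry_ofReal.isClosedEmbedding.measurableEmbedding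

/-- Distances in `[0, 1]` are at most `1`, so the negative part of the kernel vanishes. -/
theorem energy_map_ofReal {ν : Measure ℝ} [IsProbabilityMeasure ν] (hν : ν (Icc 0 1)ᶜ = 0) :
    energy (ν.map Complex.ofReal) = (mutualEnergy ν ν : EReal) := by
  have hae : ∀ᵐ x ∂ν, x ∈ Icc (0 : ℝ) 1 := hν
  have hneg : ∫⁻ y, ∫⁻ x, (-logKernel x y).toENNReal ∂ν ∂ν = 0 := by
    rw [← lintegral_zero (μ := ν)]
    refine lintegral_congr_ae ?_
    filter_upwards [hae] with y hy
    rw [← lintegral_zero (μ := ν)]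
    refine lintegral_congr_ae ?_
    filter_upwards [hae] with x hx
    rw [logKernel, neg_neg, Complex.isometry_ofReal.edist_eq, EReal.toENNReal_of_nonpos]
    rw [ENNReal.log_le_zero_iff, edist_dist, Real.dist_eq]
    exact ENNReal.ofReal_le_one.2
      (abs_le.2 ⟨by linarith [hx.1, hy.2], by linarith [hx.2, hy.1]⟩)
  simp only [energy, interaction, measurableEmbedding_ofReal.lintegral_map,
    toENNReal_logKernel_ofReal, hneg]
  simp [mutualEnergy]

/-- A measure is carried by its support, and there `z = re z`; take the image under `re`. -/
theorem exists_eq_map_ofReal {μ : Measure ℂ} [IsProbabilityMeasure μ]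
    (h : μ.support ⊆ unitInterval) :
    ∃ ν : Measure ℝ, IsProbabilityMeasure ν ∧ ν (Icc 0 1)ᶜ = 0 ∧ μ = ν.map Complex.ofReal := by
  have hae : ∀ᵐ z ∂μ, z ∈ unitInterval := by
    filter_upwards [Measure.support_mem_ae (μ := μ)] with z hz using h hz
  refine ⟨μ.map Complex.re, Measure.isProbabilityMeasure_map Complex.measurable_re.aemeasurable,
    ?_, ?_⟩
  · rw [Measure.map_apply Complex.measurable_re measurableSet_Icc.compl]
    change ∀ᵐ z ∂μ, z.re ∈ Icc (0 : ℝ) 1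
    filter_upwards [hae] with z hz
    obtain ⟨x, hx, rfl⟩ := hz
    simpa using hx
  · rw [Measure.map_map Complex.measurable_ofReal Complex.measurable_re]
    conv_lhs => rw [← Measure.map_id (μ := μ)]
    refine Measure.map_congr ?_
    filter_upwards [hae] with z hz
    obtain ⟨x, hx, rfl⟩ := hz
    simp

theorem support_map_ofReal_subset {ν : Measure ℝ} {F : Set ℝ} (hF : IsCompact F)
    (h : ν Fᶜ = 0) : (ν.map Complex.ofReal).support ⊆ Complex.ofReal '' F := by
  have hc : IsClosed (Complex.ofReal '' F) := (hF.image Complex.continuous_ofReal).isClosed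
  refine Measure.support_subset_of_isClosed hc ?_
  change (ν.map Complex.ofReal) (Complex.ofReal '' F)ᶜ = 0
  rw [Measure.map_apply Complex.measurable_ofReal hc.measurableSet.compl]
  refine measure_mono_null (fun x hx hxF => hx (mem_image_of_mem _ hxF)) h

/-- The infimum in the definition of the capacity. -/
def minEnergy (E : Set ℂ) : EReal :=
  ⨅ (μ : Measure ℂ) (_ : IsProbabilityMeasure μ) (_ : IsCompact μ.support)
    (_ : μ.support ⊆ E), energy μ

theorem capacity_eq_exp (E : Set ℂ) : capacity E = EReal.exp (-minEnergy E) := rfl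

theorem minEnergy_le_of_compact {ν : Measure ℝ} [IsProbabilityMeasure ν] {F : Set ℝ} {E : Set ℂ}
    (hF : IsCompact F) (hF1 : F ⊆ Icc 0 1) (hFE : Complex.ofReal '' F ⊆ E) (h : ν Fᶜ = 0) :
    minEnergy E ≤ (mutualEnergy ν ν : EReal) := by
  have hsub := support_map_ofReal_subset hF h
  rw [← energy_map_ofReal (measure_mono_null (compl_subset_compl.2 hF1) h)]
  exact iInf_le_of_le _ (iInf_le_of_le
    (Measure.isProbabilityMeasure_map Complex.measurable_ofReal.aemeasurable)
    (iInf_le_of_le ((hF.image Complex.continuous_ofReal).of_isClosed_subset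
      Measure.isClosed_support hsub) (iInf_le_of_le (hsub.trans hFE) le_rfl)))

theorem capacity_unitInterval_pos : 0 < capacity unitInterval := by
  rw [capacity_eq_exp, EReal.zero_lt_exp_iff, bot_lt_iff_ne_bot, Ne, EReal.neg_eq_bot_iff, ← Ne,
    ← lt_top_iff_ne_top]
  have h := unif_compl 0 1
  rw [zero_add] at h
  refine (minEnergy_le_of_compact isCompact_Icc Subset.rfl Subset.rfl h).trans_lt ?_
  have h1 : mutualEnergy (unif 0 1) (unif 0 1) ≤ ∫⁻ _, 2 ∂(unif 0 1) :=
    lintegral_mono fun y => by simpa using lintegral_logPos_unif_le 0 y one_pos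
  have h2 : mutualEnergy (unif 0 1) (unif 0 1) < ∞ := h1.trans_lt (by simp)
  exact lt_top_iff_ne_top.2 (by simpa using h2.ne)

theorem limsup_subset_Icc {c l : ℕ → ℝ} (hc : ∀ k, c k ∈ Ioo (0 : ℝ) 1)
    (hl : Tendsto l atTop (𝓝 0)) :
    ⋂ m : ℕ, ⋃ k : ℕ, ⋃ _ : m ≤ k, interval c l k ⊆ Icc 0 1 := by
  intro x hx
  have key : ∀ η : ℝ, 0 < η → -η ≤ x ∧ x ≤ 1 + η := by
    intro η hη
    obtain ⟨N, hN⟩ := eventually_atTop.1 (hl.eventually (gt_mem_nhds hη))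
    obtain ⟨k, hk, hxk⟩ := mem_iUnion₂.1 (mem_iInter.1 hx N)
    have h1 := hN k hk
    have h2 := hc k
    have h3 : c k - l k / 2 < x := hxk.1
    have h4 : x < c k + l k / 2 := hxk.2
    constructor <;> linarith [h2.1, h2.2]
  constructor
  · exact le_of_forall_pos_le_add fun η hη => by linarith [(key η hη).1]
  · exact le_of_forall_pos_le_add fun η hη => (key η hη).2

theorem minEnergy_mono {E E' : Set ℂ} (h : E ⊆ E') : minEnergy E' ≤ minEnergy E :=
  iInf_mono fun _ => iInf_mono fun _ => iInf_mono fun _ => iInf_mono' fun hs => ⟨hs.trans h, le_rfl⟩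

end LogCap

end

theorem mainTheorem1 (lam : ℝ) (hlam : 0 < lam)
    (c : ℕ → ℝ) (hc : ∀ k, c k ∈ Set.Ioo (0 : ℝ) 1)
    (l : ℕ → ℝ) (hl : ∀ k : ℕ, l k = Real.exp (-lam * (k : ℝ)))
    (φ : ℝ → ℝ) (hA1 : LogCap.Distributed c φ)
    (q : ℕ → ℕ) (hq : Filter.Tendsto q Filter.atTop Filter.atTop)
    (hA2 : LogCap.LogAverageSpacing c q)
    (hA3 : LogCap.GapControl c l q) :
    LogCap.HasFullCapacityOn (LogCap.limsupSet c l) LogCap.unitInterval ∧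
      0 < LogCap.capacity LogCap.unitInterval := by
  have hIcc := LogCap.limsup_subset_Icc hc (LogCap.tendsto_length hlam hl)
  have hsub : LogCap.limsupSet c l ⊆ LogCap.unitInterval := image_mono hIcc
  refine ⟨⟨hsub, ?_⟩, LogCap.capacity_unitInterval_pos⟩
  rw [LogCap.capacity_eq_exp, LogCap.capacity_eq_exp]
  congr 2
  refine le_antisymm ?_ (LogCap.minEnergy_mono hsub)
  refine le_iInf fun μ => le_iInf fun hμ => le_iInf fun _ => le_iInf fun hs => ?_
  obtain ⟨ν, hν, hν1, rfl⟩ := LogCap.exists_eq_map_ofReal hs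
  rw [LogCap.energy_map_ofReal hν1]
  -- Any `b` above the energy of `ν` forces that energy to be finite and leaves the room `ε = b -
  -- I(ν) > 0`; if the energy is infinite, nothing is to be shown.
  refine le_of_forall_gt_imp_ge_of_dense fun b hb => ?_
  have hb0 : 0 ≤ b := (EReal.coe_ennreal_nonneg _).trans hb.le
  rw [← EReal.coe_toENNReal hb0] at hb ⊢
  rw [EReal.coe_ennreal_lt_coe_ennreal_iff] at hb
  obtain ⟨μ', F, hμ', hF, hFS, hμF, hE⟩ := LogCap.exists_measure_on_limsup hlam hc hl hA1 hq hA2 hA3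
    hν1 hb.ne_top (tsub_pos_of_lt hb).ne'
  rw [add_tsub_cancel_of_le hb.le] at hE
  refine (LogCap.minEnergy_le_of_compact hF (hFS.trans hIcc) (image_mono hFS) hμF).trans ?_
  exact EReal.coe_ennreal_le_coe_ennreal_iff.2 hE
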